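/- Let $\mathbb S^2\subset\mathbb R^3$ be the standard unit sphere and let $(r,\theta)$, $0<r<\pi$, $\theta\in\mathbb R/2\pi\mathbb Z$, be geodesic polar coordinates about the north pole, $(r,\theta)\mapsto(\sin r\cos\theta,\sin r\sin\theta,\cos r)$. Let $\Omega\subset\mathbb S^2$ be a rotationally symmetric domain, i.e. a nonempty connected open set invariant under all rotations about the axis through the poles. Let $\varepsilon\in\{+1,-1\}$ and let $q>0$, $q\neq1$, be real. Consider in $\Omega$ the equation $$\Delta_{\mathbb S^2}u=\varepsilon\,u|u|^{q-1}.\qquad(*)$$ A solution is a real function that is of class $C^2$ and satisfies the equation at all points of $\Omega$ other than the poles (so a solution may be singular at a pole belonging to $\Omega$). On these points, a solution is called radial if it depends only on $r$, and pseudo-radial if $u(r,\theta)=h(r)w(\theta)$ for a function $h$ and a $2\pi$-periodic function $w$. (i) If $\varepsilon=+1$ or $q\neq3$, then every pseudo-radial solution of $(*)$ in $\Omega$ is radial. (ii) For every integer $k\ge2$ there is a $C^2$ solution $w_k:\mathbb R\to\mathbb R$ of the ODE $$w''+w=-w^3$$ with least positive period $\frac{2\pi}{k}$ and $w_k(0)=0$;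 it is unique up to sign among the solutions with these properties, and every solution of the ODE with least period $\frac{2\pi}{k}$ is a translate $\theta\mapsto w_k(\theta+c)$, $c\in\mathbb R$. The equation $\Delta_{\mathbb S^2}u=-u^3$ admits infinitely many non-radial pseudo-radial solutions in $\Omega$ (as functions on $\Omega$ without the poles), and these are exactly the functions of the form $$u(r,\theta)=\frac{w_k(\theta+c)}{\sin r},\qquad k\ge2,\ c\in\mathbb R.$$ -/

import Mathlib

noncomputable section

/-- Euclidean three-space. -/
abbrev E3 : Type := EuclideanSpace ℝ (Fin 3)

/-- The standard unit sphere `S²`. -/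
abbrev S2 : Type := Metric.sphere (0 : E3) 1

theorem normalize_mem_S2 {x : E3} (hx : x ≠ 0) : ‖x‖⁻¹ • x ∈ Metric.sphere (0 : E3) 1 := by
  have h : ‖x‖ ≠ 0 := norm_ne_zero_iff.mpr hx
  simp [norm_smul, h]

/-- The extension of `u : S² → ℝ` to `ℝ³ ∖ {0}` which is constant along rays,
`x ↦ u (x / ‖x‖)` (with the irrelevant value `0` at the origin). -/
def radialExtension (u : S2 → ℝ) (x : E3) : ℝ :=
  open Classical in if hx : x = 0 then 0 else u ⟨‖x‖⁻¹ • x, normalize_mem_S2 hx⟩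

/-- The Laplace–Beltrami operator of the round sphere: the restriction to `S²` of the Euclidean
Laplacian of the extension of `u` that is constant along rays. -/
def sphereLaplacian (u : S2 → ℝ) (x : S2) : ℝ :=
  Laplacian.laplacian (radialExtension u) (x : E3)

theorem polarPoint_mem (r θ : ℝ) :
    (!₂[Real.sin r * Real.cos θ, Real.sin r * Real.sin θ, Real.cos r] : E3) ∈
      Metric.sphere (0 : E3) 1 := by
  rw [mem_sphere_zero_iff_norm, EuclideanSpace.norm_eq, Real.sqrt_eq_one, Fin.sum_univ_three]
  simp only [Real.norm_eq_abs, sq_abs]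
  simp
  nlinarith [Real.sin_sq_add_cos_sq r, Real.sin_sq_add_cos_sq θ]

/-- The point of `S²` with geodesic polar coordinates `(r, θ)` about the north pole. -/
def polarPoint (r θ : ℝ) : S2 :=
  ⟨!₂[Real.sin r * Real.cos θ, Real.sin r * Real.sin θ, Real.cos r], polarPoint_mem r θ⟩

theorem axialRotation_mem (α : ℝ) (x : S2) :
    (!₂[Real.cos α * x.1 0 - Real.sin α * x.1 1, Real.sin α * x.1 0 + Real.cos α * x.1 1,
      x.1 2] : E3) ∈ Metric.sphere (0 : E3) 1 := by
  have hx := x.2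
  rw [mem_sphere_zero_iff_norm, EuclideanSpace.norm_eq, Real.sqrt_eq_one,
    Fin.sum_univ_three] at hx ⊢
  simp only [Real.norm_eq_abs, sq_abs] at hx ⊢
  simp
  linear_combination hx + ((x.1 0) ^ 2 + (x.1 1) ^ 2) * Real.sin_sq_add_cos_sq α

/-- Rotation of `S²` by the angle `α` about the vertical axis. -/
def axialRotation (α : ℝ) (x : S2) : S2 :=
  ⟨!₂[Real.cos α * x.1 0 - Real.sin α * x.1 1, Real.sin α * x.1 0 + Real.cos α * x.1 1, x.1 2],
    axialRotation_mem α x⟩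

/-- A domain (nonempty connected open set) of `S²` invariant under all rotations about the
vertical axis: a geodesic disc or annulus centred at a pole, the whole sphere, and so on. -/
structure IsRotSymmDomain (Ω : Set S2) : Prop where
  isOpen : IsOpen Ω
  isConnected : IsConnected Ω
  rotation_mem : ∀ (α : ℝ), ∀ x ∈ Ω, axialRotation α x ∈ Ω

/-- The points of `Ω` other than the two poles, i.e. the part of `Ω` covered by the polar
coordinates `(r, θ)` with `0 < r < π`. -/
def awayFromPoles (Ω : Set S2) : Set S2 :=
  {x | ∃ r ∈ Set.Ioo 0 Real.pi, ∃ θ : ℝ, x = polarPoint r θ ∧ x ∈ Ω}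

/-- `u` is a classical solution of `Δ_{S²} u = f(u)` in `Ω`, possibly singular at the poles:
it is `C²` and satisfies the equation at every point of `Ω` other than the poles. -/
def IsSphereSolution (Ω : Set S2) (f : ℝ → ℝ) (u : S2 → ℝ) : Prop :=
  ∀ x ∈ awayFromPoles Ω,
    ContDiffAt ℝ 2 (radialExtension u) (x : E3) ∧ sphereLaplacian u x = f (u x)

/-- `u(r, θ) = h(r)` in polar coordinates on `Ω`. -/
def IsRadial (Ω : Set S2) (u : S2 → ℝ) : Prop :=
  ∃ h : ℝ → ℝ, ∀ r ∈ Set.Ioo 0 Real.pi, ∀ θ : ℝ,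
    polarPoint r θ ∈ Ω → u (polarPoint r θ) = h r

/-- `u(r, θ) = h(r) w(θ)` in polar coordinates on `Ω`, with `w` a `2π`-periodic function. -/
def IsPseudoRadial (Ω : Set S2) (u : S2 → ℝ) : Prop :=
  ∃ h w : ℝ → ℝ, Function.Periodic w (2 * Real.pi) ∧
    ∀ r ∈ Set.Ioo 0 Real.pi, ∀ θ : ℝ,
      polarPoint r θ ∈ Ω → u (polarPoint r θ) = h r * w θ

/-- `w` is a (global, `C²`) solution of the ODE `w'' + w = -w³`. -/
def SolvesODE (w : ℝ → ℝ) : Prop :=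
  ContDiff ℝ 2 w ∧ ∀ θ : ℝ, iteratedDeriv 2 w θ + w θ = -(w θ) ^ 3

/-- `T` is the least positive period of `w`. -/
def HasLeastPeriod (w : ℝ → ℝ) (T : ℝ) : Prop :=
  IsLeast {t : ℝ | 0 < t ∧ Function.Periodic w t} T

/-- The set of non-radial pseudo-radial solutions of `Δ_{S²} u = -u³` in `Ω`. -/
def nonradialPseudoRadialSolutions (Ω : Set S2) : Set (S2 → ℝ) :=
  {u | IsSphereSolution Ω (fun t => -t ^ 3) u ∧ IsPseudoRadial Ω u ∧ ¬ IsRadial Ω u}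

end

/-!
A non-radial solution `u = h(r) w(θ)` satisfies, at every radius where `h ≠ 0`, an equation
`w'' = -A(r) w + ε κ(r) w|w|^(q-1)` in `θ` alone, with `κ = |h|^(q-1) sin² r`. Since `w` takes two
values, the coefficients `A` and `κ` do not depend on `r`. Constancy of `κ` makes `h` locally a
multiple of `(sin r)^p` with `p = 2 / (1 - q)`, and then `A = (p² + p) cos² r - p`; its constancy
forces `p = -1`, that is `q = 3`, and `W = (h sin r) w` is a `2π`-periodic solution of
`W'' + W = ε W³`.

For `ε > 0` such a solution is constant. If it has no zero, `W' (W - 1 / W)` (after rescaling to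
`ε = 1`) is periodic and nondecreasing. If it has one, it is odd about that zero and hence vanishes
at distance `π`, so that Picone's identity against the sine shows `W = 0`.

For `ε = -1`, the substitution `W = a sin φ` turns the energy identity into a first order equation
for the phase `φ`, whose right-hand side increases with the amplitude `a`. So the period decreases
strictly with `a`, from `2π` to `0`, and every `T` in `(0, 2π)` is the least period of exactly one
oscillation up to translation.
-/

open Real Filter Topology Set

/-! ### Newton's equation on the line -/

theorem eq_of_hasDerivAt_of_contDiff {E : Type*} [NormedAddCommGroup E] [NormedSpace ℝ E]
    {V : E → E} (hV : ContDiff ℝ 1 V) {γ δ : ℝ → E} (hγ : ∀ t, HasDerivAt γ (V (γ t)) t)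
    (hδ : ∀ t, HasDerivAt δ (V (δ t)) t) {t₀ : ℝ} (h₀ : γ t₀ = δ t₀) : γ = δ := by
  have cont {η : ℝ → E} (hη : ∀ t, HasDerivAt η (V (η t)) t) : Continuous η :=
    continuous_iff_continuousAt.2 fun t => (hη t).continuousAt
  have hclopen : IsClopen {t | γ t = δ t} := by
    refine ⟨isClosed_eq (cont hγ) (cont hδ), isOpen_iff_mem_nhds.2 fun t ht => ?_⟩
    obtain ⟨K, s, hs, hK⟩ := (hV.contDiffAt (x := γ t)).exists_lipschitzOnWith
    have hδs : ∀ᶠ t' in 𝓝 t, δ t' ∈ s :=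
      (cont hδ).continuousAt.eventually_mem (show s ∈ 𝓝 (δ t) from ht ▸ hs)
    exact ODE_solution_unique_of_eventually (v := fun _ => V) (s := fun _ => s)
      (Eventually.of_forall fun _ => hK)
      (((cont hγ).continuousAt.eventually_mem hs).mono fun t' h => ⟨hγ t', h⟩)
      (hδs.mono fun t' h => ⟨hδ t', h⟩) ht
  exact funext (Set.eq_univ_iff_forall.1 (hclopen.eq_univ ⟨t₀, h₀⟩))

/-- `w` is a global classical solution of Newton's equation `w'' = f(w)`. -/
structure IsNewtonSolution (f w : ℝ → ℝ) : Prop where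
  hasDerivAt : ∀ t, HasDerivAt w (deriv w t) t
  hasDerivAt_deriv : ∀ t, HasDerivAt (deriv w) (f (w t)) t

namespace IsNewtonSolution

variable {f v w p : ℝ → ℝ}

theorem of_hasDerivAt (hw : ∀ t, HasDerivAt w (p t) t) (hp : ∀ t, HasDerivAt p (f (w t)) t) :
    IsNewtonSolution f w := by
  have hderiv : deriv w = p := funext fun t => (hw t).deriv
  exact ⟨fun t => hderiv ▸ hw t, hderiv ▸ hp⟩

protected theorem continuous (hw : IsNewtonSolution f w) : Continuous w :=
  continuous_iff_continuousAt.2 fun t => (hw.hasDerivAt t).continuousAt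

theorem continuous_deriv (hw : IsNewtonSolution f w) : Continuous (deriv w) :=
  continuous_iff_continuousAt.2 fun t => (hw.hasDerivAt_deriv t).continuousAt

theorem comp_add_const (hw : IsNewtonSolution f w) (c : ℝ) :
    IsNewtonSolution f fun t => w (t + c) :=
  of_hasDerivAt (fun t => (hw.hasDerivAt (t + c)).comp_add_const t c)
    fun t => (hw.hasDerivAt_deriv (t + c)).comp_add_const t c

theorem comp_const_sub (hw : IsNewtonSolution f w) (c : ℝ) :
    IsNewtonSolution f fun t => w (c - t) :=
  of_hasDerivAt (fun t => (hw.hasDerivAt (c - t)).comp_const_sub c t)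
    fun t => by simpa using ((hw.hasDerivAt_deriv (c - t)).comp_const_sub c t).fun_neg

protected theorem neg (hf : f.Odd) (hw : IsNewtonSolution f w) :
    IsNewtonSolution f fun t => -w t :=
  of_hasDerivAt (fun t => (hw.hasDerivAt t).neg)
    fun t => (hf (w t)).symm ▸ (hw.hasDerivAt_deriv t).neg

protected theorem const {c : ℝ} (hc : f c = 0) : IsNewtonSolution f fun _ => c :=
  of_hasDerivAt (fun t => hasDerivAt_const t c) fun t => hc.symm ▸ hasDerivAt_const t 0

theorem eq_of_initial_data (hf : ContDiff ℝ 1 f) (hv : IsNewtonSolution f v)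
    (hw : IsNewtonSolution f w) {t₀ : ℝ} (h : v t₀ = w t₀) (h' : deriv v t₀ = deriv w t₀) :
    v = w := by
  have hV : ContDiff ℝ 1 fun z : ℝ × ℝ => (z.2, f z.1) :=
    contDiff_snd.prodMk (hf.comp contDiff_fst)
  have key := eq_of_hasDerivAt_of_contDiff hV (t₀ := t₀)
    (fun t => (hv.hasDerivAt t).prodMk (hv.hasDerivAt_deriv t))
    (fun t => (hw.hasDerivAt t).prodMk (hw.hasDerivAt_deriv t)) (Prod.ext h h')
  exact funext fun t => congrArg Prod.fst (congrFun key t)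

end IsNewtonSolution

theorem isNewtonSolution_iff {f w : ℝ → ℝ} (hf : Continuous f) :
    IsNewtonSolution f w ↔ ContDiff ℝ 2 w ∧ ∀ t, iteratedDeriv 2 w t = f (w t) := by
  simp only [show iteratedDeriv 2 w = deriv (deriv w) by rw [iteratedDeriv_succ, iteratedDeriv_one],
    show (2 : WithTop ℕ∞) = 1 + 1 from one_add_one_eq_two.symm, contDiff_succ_iff_deriv,
    contDiff_one_iff_deriv]
  refine ⟨fun hw => ?_, fun ⟨⟨hw, _, hw', _⟩, h⟩ =>
    ⟨fun t => (hw t).hasDerivAt, fun t => h t ▸ (hw' t).hasDerivAt⟩⟩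
  have hderiv : deriv (deriv w) = fun t => f (w t) := funext fun t => (hw.hasDerivAt_deriv t).deriv
  exact ⟨⟨fun t => (hw.hasDerivAt t).differentiableAt, by simp,
    fun t => (hw.hasDerivAt_deriv t).differentiableAt, hderiv ▸ hf.comp hw.continuous⟩,
    congrFun hderiv⟩

namespace Duffing

/-- The restoring force of the Duffing oscillator `w'' = -w - w³`. -/
def force (x : ℝ) : ℝ := -x - x ^ 3

theorem contDiff_force : ContDiff ℝ 1 force := by
  unfold force
  fun_prop

theorem odd_force : force.Odd := fun x => by
  simp only [force]
  ring

end Duffing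

theorem solvesODE_iff {w : ℝ → ℝ} : SolvesODE w ↔ IsNewtonSolution Duffing.force w := by
  rw [isNewtonSolution_iff Duffing.contDiff_force.continuous, SolvesODE]
  refine and_congr_right' (forall_congr' fun θ => ?_)
  rw [Duffing.force, ← eq_sub_iff_add_eq, neg_sub_comm]

/-! ### Duffing oscillations -/

namespace Duffing

/-- The angular speed `φ'` at phase `φ` of the oscillation `w = a sin φ` of amplitude `a`. It comes
from the energy identity `w'² + w² + w⁴ / 2 = a² + a⁴ / 2`. -/
noncomputable def angularSpeed (a φ : ℝ) : ℝ := √(1 + a ^ 2 * (1 + sin φ ^ 2) / 2)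

theorem angularSpeed_sq (a φ : ℝ) : angularSpeed a φ ^ 2 = 1 + a ^ 2 * (1 + sin φ ^ 2) / 2 :=
  sq_sqrt (by positivity)

theorem angularSpeed_pos (a φ : ℝ) : 0 < angularSpeed a φ := sqrt_pos.2 (by positivity)

theorem angularSpeed_of_sin_eq_zero {a φ : ℝ} (hφ : sin φ = 0) :
    angularSpeed a φ = angularSpeed a 0 := by
  simp [angularSpeed, hφ]

theorem angularSpeed_zero_right_le (a φ : ℝ) : angularSpeed a 0 ≤ angularSpeed a φ := by
  refine sqrt_le_sqrt ?_
  rw [sin_zero, zero_pow two_ne_zero]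
  gcongr
  exact sq_nonneg _

theorem angularSpeed_lt {a b : ℝ} (ha : 0 ≤ a) (hab : a < b) (φ : ℝ) :
    angularSpeed a φ < angularSpeed b φ := by
  refine sqrt_lt_sqrt (by positivity) ?_
  gcongr

theorem continuous_angularSpeed : Continuous fun z : ℝ × ℝ => angularSpeed z.1 z.2 := by
  unfold angularSpeed
  fun_prop

theorem continuous_inv_angularSpeed (a : ℝ) : Continuous fun φ => (angularSpeed a φ)⁻¹ :=
  (continuous_angularSpeed.comp (by fun_prop : Continuous fun φ : ℝ => (a, φ))).inv₀
    fun φ => (angularSpeed_pos a φ).ne'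

theorem hasDerivAt_angularSpeed (a φ : ℝ) :
    HasDerivAt (angularSpeed a) (a ^ 2 * sin φ * cos φ / (2 * angularSpeed a φ)) φ := by
  have h : HasDerivAt (fun φ => 1 + a ^ 2 * (1 + sin φ ^ 2) / 2) (a ^ 2 * sin φ * cos φ) φ :=
    (((((hasDerivAt_sin φ).pow 2).const_add 1).const_mul (a ^ 2)).div_const 2 |>.const_add
      1).congr_deriv (by ring)
  exact h.sqrt (by positivity)

theorem periodic_inv_angularSpeed (a : ℝ) :
    Function.Periodic (fun φ => (angularSpeed a φ)⁻¹) (2 * π) := fun φ => by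
  simp only [angularSpeed, sin_add_two_pi]

/-- The time which the oscillation of amplitude `a` takes from phase `0` to phase `φ`. -/
noncomputable def elapsedTime (a φ : ℝ) : ℝ := ∫ x in (0 : ℝ)..φ, (angularSpeed a x)⁻¹

theorem hasDerivAt_elapsedTime (a φ : ℝ) : HasDerivAt (elapsedTime a) (angularSpeed a φ)⁻¹ φ :=
  ((continuous_inv_angularSpeed a).integral_hasStrictDerivAt 0 φ).hasDerivAt

theorem strictMono_elapsedTime (a : ℝ) : StrictMono (elapsedTime a) :=
  strictMono_of_hasDerivAt_pos (hasDerivAt_elapsedTime a) fun φ => inv_pos.2 (angularSpeed_pos a φ)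

theorem surjective_elapsedTime (a : ℝ) : Function.Surjective (elapsedTime a) := by
  have hint := (continuous_inv_angularSpeed a).intervalIntegrable (μ := MeasureTheory.volume)
  have hpos (φ : ℝ) : 0 < (angularSpeed a φ)⁻¹ := inv_pos.2 (angularSpeed_pos a φ)
  have hcont : Continuous (elapsedTime a) :=
    continuous_iff_continuousAt.2 fun φ => (hasDerivAt_elapsedTime a φ).continuousAt
  exact hcont.surjective
    ((periodic_inv_angularSpeed a).tendsto_atTop_intervalIntegral_of_pos' (hint _ _) hpos
      two_pi_pos)
    ((periodic_inv_angularSpeed a).tendsto_atBot_intervalIntegral_of_pos' (hint _ _) hpos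
      two_pi_pos)

@[simp]
theorem elapsedTime_zero_right (a : ℝ) : elapsedTime a 0 = 0 := by simp [elapsedTime]

/-- The phase, as a function of time, of the oscillation of amplitude `a` which has phase `0` at
time `0`. -/
noncomputable def phase (a : ℝ) : ℝ → ℝ :=
  ((strictMono_elapsedTime a).orderIsoOfSurjective _ (surjective_elapsedTime a)).symm

@[simp]
theorem elapsedTime_phase (a t : ℝ) : elapsedTime a (phase a t) = t :=
  ((strictMono_elapsedTime a).orderIsoOfSurjective _ (surjective_elapsedTime a)).apply_symm_apply t

@[simp]
theorem phase_elapsedTime (a φ : ℝ) : phase a (elapsedTime a φ) = φ :=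
  (strictMono_elapsedTime a).injective (elapsedTime_phase a _)

@[simp]
theorem phase_zero_right (a : ℝ) : phase a 0 = 0 := by
  simpa using phase_elapsedTime a 0

theorem hasDerivAt_phase (a t : ℝ) : HasDerivAt (phase a) (angularSpeed a (phase a t)) t := by
  have hcont : Continuous (phase a) := OrderIso.continuous _
  simpa using (hasDerivAt_elapsedTime a (phase a t)).of_local_left_inverse hcont.continuousAt
    (inv_pos.2 (angularSpeed_pos _ _)).ne' (Eventually.of_forall (elapsedTime_phase a))

/-- The solution of Duffing's equation of amplitude `a` that starts at `0`. -/
noncomputable def oscillation (a t : ℝ) : ℝ := a * sin (phase a t)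

@[simp]
theorem oscillation_zero_right (a : ℝ) : oscillation a 0 = 0 := by simp [oscillation]

theorem hasDerivAt_oscillation (a t : ℝ) :
    HasDerivAt (oscillation a) (a * cos (phase a t) * angularSpeed a (phase a t)) t :=
  ((hasDerivAt_phase a t).sin.const_mul a).congr_deriv (mul_assoc _ _ _).symm

theorem deriv_oscillation (a t : ℝ) :
    deriv (oscillation a) t = a * cos (phase a t) * angularSpeed a (phase a t) :=
  (hasDerivAt_oscillation a t).deriv

theorem isNewtonSolution_oscillation (a : ℝ) : IsNewtonSolution force (oscillation a) := by
  refine .of_hasDerivAt (hasDerivAt_oscillation a) fun t => ?_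
  have hω := (angularSpeed_pos a (phase a t)).ne'
  have h := ((hasDerivAt_phase a t).cos.const_mul a).mul
    ((hasDerivAt_angularSpeed a (phase a t)).comp t (hasDerivAt_phase a t))
  refine h.congr_deriv ?_
  simp only [force, oscillation, Function.comp_apply]
  field_simp
  rw [angularSpeed_sq, cos_sq']
  ring

theorem exists_amplitude_of_energy {E : ℝ} (hE : 0 ≤ E) : ∃ a ≥ 0, a ^ 2 + a ^ 4 / 2 = E := by
  refine ⟨√(√(1 + 2 * E) - 1), sqrt_nonneg _, ?_⟩
  have h₁ : √(1 + 2 * E) ^ 2 = 1 + 2 * E := sq_sqrt (by positivity)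
  have h₂ : √(√(1 + 2 * E) - 1) ^ 2 = √(1 + 2 * E) - 1 :=
    sq_sqrt (sub_nonneg.2 (one_le_sqrt.2 (by linarith)))
  rw [show 4 = 2 * 2 from rfl, pow_mul, h₂]
  linear_combination h₁ / 2

/-- The phase is the argument of `p / √(1 + (a² + v²) / 2) + i v`, whose modulus is `a`. -/
theorem exists_amplitude_phase (v p : ℝ) :
    ∃ a ≥ 0, ∃ φ, v = a * sin φ ∧ p = a * cos φ * angularSpeed a φ := by
  obtain ⟨a, ha, hE⟩ := exists_amplitude_of_energy (E := p ^ 2 + v ^ 2 + v ^ 4 / 2) (by positivity)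
  set D := √(1 + (a ^ 2 + v ^ 2) / 2)
  have hD : D ^ 2 = 1 + (a ^ 2 + v ^ 2) / 2 := sq_sqrt (by positivity)
  have hD₀ : 0 < D := sqrt_pos.2 (by positivity)
  set z : ℂ := ⟨p / D, v⟩
  have hnorm : ‖z‖ = a := by
    refine (pow_left_inj₀ (norm_nonneg z) ha two_ne_zero).1 ?_
    rw [Complex.sq_norm, Complex.normSq_mk, div_mul_div_comm]
    field_simp
    rw [hD]
    linear_combination -hE
  have hv : v = a * sin z.arg := by rw [← hnorm, Complex.norm_mul_sin_arg]
  refine ⟨a, ha, z.arg, hv, ?_⟩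
  have hω : angularSpeed a z.arg = D := by
    rw [angularSpeed, mul_add, mul_one, ← mul_pow, ← hv]
  rw [hω, ← hnorm, Complex.norm_mul_cos_arg, div_mul_cancel₀ _ hD₀.ne']

theorem exists_eq_oscillation {w : ℝ → ℝ} (hw : IsNewtonSolution force w) :
    ∃ a ≥ 0, ∃ c, w = fun t => oscillation a (t + c) := by
  obtain ⟨a, ha, φ, hv, hp⟩ := exists_amplitude_phase (w 0) (deriv w 0)
  refine ⟨a, ha, elapsedTime a φ, hw.eq_of_initial_data contDiff_force
    ((isNewtonSolution_oscillation a).comp_add_const _) (t₀ := 0) ?_ ?_⟩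
  · simpa [oscillation] using hv
  · simpa [deriv_comp_add_const, deriv_oscillation] using hp

theorem translate_eq_oscillation_or_eq_neg {a c : ℝ} (hc : oscillation a c = 0) :
    (fun t => oscillation a (t + c)) = oscillation a ∨
      (fun t => oscillation a (t + c)) = -oscillation a := by
  have hw := isNewtonSolution_oscillation a
  rcases mul_eq_zero.1 hc with rfl | hsin
  · exact .inl (funext fun t => by simp [oscillation])
  have hω := angularSpeed_of_sin_eq_zero (a := a) hsin
  refine (sin_eq_zero_iff_cos_eq.1 hsin).imp (fun hcos => ?_) fun hcos => ?_
  · refine (hw.comp_add_const c).eq_of_initial_data contDiff_force hw (t₀ := 0) (by simp [hc]) ?_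
    simp [deriv_comp_add_const, deriv_oscillation, hcos, hω]
  · refine (hw.comp_add_const c).eq_of_initial_data contDiff_force (hw.neg odd_force) (t₀ := 0)
      (by simp [hc]) ?_
    simp [deriv_comp_add_const, deriv_oscillation, hcos, hω]

/-- The period of the oscillation of amplitude `a`; its limit at `a = 0`, where the oscillation
vanishes, is the period `2π` of the linearized equation. -/
noncomputable def period (a : ℝ) : ℝ := elapsedTime a (2 * π)

theorem elapsedTime_int_mul_two_pi (a : ℝ) (n : ℤ) :
    elapsedTime a (n * (2 * π)) = n * period a := by
  simpa [elapsedTime, period] using (periodic_inv_angularSpeed a).intervalIntegral_add_zsmul_eq n 0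
    fun _ _ => (continuous_inv_angularSpeed a).intervalIntegrable _ _

theorem phase_add_period (a t : ℝ) : phase a (t + period a) = phase a t + 2 * π := by
  refine (strictMono_elapsedTime a).injective ?_
  have h := (periodic_inv_angularSpeed a).intervalIntegral_add_eq_add 0 (phase a t)
    fun _ _ => (continuous_inv_angularSpeed a).intervalIntegrable _ _
  rw [zero_add] at h
  rw [elapsedTime_phase, elapsedTime, h, ← elapsedTime, elapsedTime_phase, period, elapsedTime]

theorem period_pos (a : ℝ) : 0 < period a := by
  simpa [period] using strictMono_elapsedTime a two_pi_pos

theorem periodic_oscillation (a : ℝ) : Function.Periodic (oscillation a) (period a) := fun t => by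
  simp [oscillation, phase_add_period]

theorem exists_eq_int_mul_period {a t : ℝ} (ha : a ≠ 0)
    (ht : Function.Periodic (oscillation a) t) : ∃ n : ℤ, t = n * period a := by
  have hsin : sin (phase a t) = 0 := by simpa [oscillation, ha] using ht 0
  have hcos : cos (phase a t) = 1 := by
    have h : deriv (oscillation a) (0 + t) = deriv (oscillation a) 0 := by
      rw [← deriv_comp_add_const, funext ht]
    simpa [deriv_oscillation, angularSpeed_of_sin_eq_zero hsin, ha, (angularSpeed_pos a 0).ne']
      using h
  obtain ⟨n, hn⟩ := (cos_eq_one_iff _).1 hcos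
  exact ⟨n, by rw [← elapsedTime_int_mul_two_pi, hn, elapsedTime_phase]⟩

theorem exists_eq_nat_mul_period {a t : ℝ} (ha : a ≠ 0) (ht₀ : 0 < t)
    (ht : Function.Periodic (oscillation a) t) : ∃ n : ℕ, 0 < n ∧ t = n * period a := by
  obtain ⟨n, rfl⟩ := exists_eq_int_mul_period ha ht
  have hn : 0 < n := by exact_mod_cast (pos_iff_pos_of_mul_pos ht₀).2 (period_pos a)
  lift n to ℕ using hn.le
  exact ⟨n, by exact_mod_cast hn, by simp⟩

theorem hasLeastPeriod_oscillation {a : ℝ} (ha : a ≠ 0) :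
    HasLeastPeriod (oscillation a) (period a) := by
  refine ⟨⟨period_pos a, periodic_oscillation a⟩, fun t ⟨ht₀, ht⟩ => ?_⟩
  obtain ⟨n, hn, rfl⟩ := exists_eq_nat_mul_period ha ht₀ ht
  exact le_mul_of_one_le_left (period_pos a).le (by exact_mod_cast hn)

theorem continuous_period : Continuous period :=
  intervalIntegral.continuous_parametric_intervalIntegral_of_continuous'
    (continuous_angularSpeed.inv₀ fun z => (angularSpeed_pos z.1 z.2).ne') 0 (2 * π)

theorem strictAntiOn_period : StrictAntiOn period (Ici 0) := fun a ha b _ hab => by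
  have h (φ : ℝ) : (angularSpeed b φ)⁻¹ < (angularSpeed a φ)⁻¹ :=
    inv_strictAnti₀ (angularSpeed_pos a φ) (angularSpeed_lt ha hab φ)
  exact intervalIntegral.integral_lt_integral_of_continuousOn_of_le_of_exists_lt two_pi_pos
    (continuous_inv_angularSpeed b).continuousOn (continuous_inv_angularSpeed a).continuousOn
    (fun φ _ => (h φ).le) ⟨0, left_mem_Icc.2 two_pi_pos.le, h 0⟩

@[simp]
theorem period_zero : period 0 = 2 * π := by simp [period, elapsedTime, angularSpeed]

theorem period_le (a : ℝ) : period a ≤ 2 * π / angularSpeed a 0 := by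
  have h := intervalIntegral.integral_mono_on two_pi_pos.le
    ((continuous_inv_angularSpeed a).intervalIntegrable (μ := MeasureTheory.volume) _ _)
    (intervalIntegrable_const (c := (angularSpeed a 0)⁻¹)) fun φ _ =>
      inv_anti₀ (angularSpeed_pos a 0) (angularSpeed_zero_right_le a φ)
  simpa [period, elapsedTime, div_eq_mul_inv] using h

theorem exists_period_lt {T : ℝ} (hT : 0 < T) : ∃ a > 0, period a < T := by
  refine ⟨4 * π / T, by positivity, (period_le _).trans_lt ?_⟩
  rw [div_lt_comm₀ (angularSpeed_pos _ _) hT]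
  refine lt_sqrt_of_sq_lt ?_
  rw [sin_zero]
  linarith [sq_nonneg (2 * π / T), show (4 * π / T) ^ 2 = 4 * (2 * π / T) ^ 2 by ring]

theorem bijOn_period : BijOn period (Ioi 0) (Ioo 0 (2 * π)) := by
  refine ⟨fun a ha => ⟨period_pos a, ?_⟩, strictAntiOn_period.injOn.mono Ioi_subset_Ici_self,
    fun T hT => ?_⟩
  · simpa using strictAntiOn_period self_mem_Ici (mem_Ici_of_Ioi ha) ha
  · obtain ⟨b, hb, hbT⟩ := exists_period_lt hT.1
    obtain ⟨a, ha, rfl⟩ := intermediate_value_Ioo' hb.le continuous_period.continuousOn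
      ⟨hbT, by simpa using hT.2⟩
    exact ⟨a, ha.1, rfl⟩

/-- The positive amplitude of the oscillation of period `T`, for `0 < T < 2π`. -/
noncomputable def amplitude : ℝ → ℝ := Function.invFunOn period (Ioi 0)

theorem amplitude_pos {T : ℝ} (hT : T ∈ Ioo 0 (2 * π)) : 0 < amplitude T :=
  bijOn_period.surjOn.mapsTo_invFunOn hT

theorem period_amplitude {T : ℝ} (hT : T ∈ Ioo 0 (2 * π)) : period (amplitude T) = T :=
  bijOn_period.surjOn.rightInvOn_invFunOn hT

theorem amplitude_period {a : ℝ} (ha : 0 < a) : amplitude (period a) = a :=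
  bijOn_period.injOn.leftInvOn_invFunOn ha

end Duffing

theorem not_hasLeastPeriod_const (x T : ℝ) : ¬HasLeastPeriod (fun _ => x) T := fun h => by
  have hT : T ≤ T / 2 := h.2 ⟨half_pos h.1.1, fun _ => rfl⟩
  linarith [h.1.1]

theorem hasLeastPeriod_comp_add_const_iff {w : ℝ → ℝ} {T : ℝ} (c : ℝ) :
    HasLeastPeriod (fun t => w (t + c)) T ↔ HasLeastPeriod w T := by
  have h (t : ℝ) : Function.Periodic (fun t => w (t + c)) t ↔ Function.Periodic w t :=
    ⟨fun ht => by simpa using ht.add_const (-c), fun ht => ht.add_const c⟩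
  simp only [HasLeastPeriod, h]

namespace Duffing

theorem exists_pos_eq_oscillation {w : ℝ → ℝ} (hw : IsNewtonSolution force w) (hw₀ : w ≠ 0) :
    ∃ a > 0, ∃ c, w = fun t => oscillation a (t + c) := by
  obtain ⟨a, ha, c, rfl⟩ := exists_eq_oscillation hw
  refine ⟨a, ha.lt_of_ne' ?_, c, rfl⟩
  rintro rfl
  exact hw₀ (funext fun t => by simp [oscillation])

theorem hasLeastPeriod_oscillation_amplitude {T : ℝ} (hT : T ∈ Ioo 0 (2 * π)) :
    HasLeastPeriod (oscillation (amplitude T)) T := by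
  simpa only [period_amplitude hT] using hasLeastPeriod_oscillation (amplitude_pos hT).ne'

theorem exists_eq_translate_of_hasLeastPeriod {w : ℝ → ℝ} (hw : IsNewtonSolution force w) {T : ℝ}
    (hT : HasLeastPeriod w T) : ∃ c, w = fun t => oscillation (amplitude T) (t + c) := by
  have hw₀ : w ≠ 0 := by
    rintro rfl
    exact not_hasLeastPeriod_const 0 T hT
  obtain ⟨a, ha, c, rfl⟩ := exists_pos_eq_oscillation hw hw₀
  rw [hasLeastPeriod_comp_add_const_iff] at hT
  exact ⟨c, by rw [hT.unique (hasLeastPeriod_oscillation ha.ne'), amplitude_period ha]⟩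

theorem eq_or_eq_neg_of_hasLeastPeriod {w : ℝ → ℝ} (hw : IsNewtonSolution force w) {T : ℝ}
    (hT : HasLeastPeriod w T) (hw₀ : w 0 = 0) :
    w = oscillation (amplitude T) ∨ w = -oscillation (amplitude T) := by
  obtain ⟨c, rfl⟩ := exists_eq_translate_of_hasLeastPeriod hw hT
  exact translate_eq_oscillation_or_eq_neg (by simpa using hw₀)

theorem exists_hasLeastPeriod_two_pi_div {w : ℝ → ℝ} (hw : IsNewtonSolution force w)
    (hw₀ : w ≠ 0) (hper : Function.Periodic w (2 * π)) :
    ∃ k : ℕ, 2 ≤ k ∧ HasLeastPeriod w (2 * π / k) := by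
  obtain ⟨a, ha, c, rfl⟩ := exists_pos_eq_oscillation hw hw₀
  obtain ⟨k, hk, hper⟩ := exists_eq_nat_mul_period ha.ne' two_pi_pos
    (by simpa using hper.add_const (-c))
  have hk₁ : k ≠ 1 := fun h => (bijOn_period.mapsTo ha).2.ne' (by simpa [h] using hper)
  refine ⟨k, by omega, (hasLeastPeriod_comp_add_const_iff c).2 ?_⟩
  rw [hper, mul_div_cancel_left₀ _ (by positivity)]
  exact hasLeastPeriod_oscillation ha.ne'

end Duffing

/-! ### Periodic solutions of the defocusing equation -/

theorem eq_zero_of_hasDerivAt_nonneg_of_eq {g g' : ℝ → ℝ} {a b : ℝ}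
    (hcont : ContinuousOn g (Icc a b)) (hg : ∀ t ∈ Ioo a b, HasDerivAt g (g' t) t)
    (hg' : ∀ t ∈ Ioo a b, 0 ≤ g' t) (hab : g a = g b) : ∀ t ∈ Ioo a b, g' t = 0 := by
  intro t ht
  have hle : a ≤ b := (ht.1.trans ht.2).le
  have hmono : MonotoneOn g (Icc a b) := by
    refine monotoneOn_of_hasDerivWithinAt_nonneg (f' := g') (convex_Icc a b) hcont ?_ ?_
    · rw [interior_Icc]
      exact fun x hx => (hg x hx).hasDerivWithinAt
    · rwa [interior_Icc]
  have hconst : g =ᶠ[𝓝 t] fun _ => g a := by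
    filter_upwards [Ioo_mem_nhds ht.1 ht.2] with x hx
    refine le_antisymm ?_ (hmono (left_mem_Icc.2 hle) (Ioo_subset_Icc_self hx) hx.1.le)
    exact hab ▸ hmono (Ioo_subset_Icc_self hx) (right_mem_Icc.2 hle) hx.2.le
  exact (hg t ht).unique ((hasDerivAt_const t (g a)).congr_of_eventuallyEq hconst)

/-- The value of the quotient at `a` is `0`, since `x / 0 = 0`. -/
theorem continuousAt_sq_mul_cos_div_sin {w : ℝ → ℝ} {a c : ℝ} (hw : DifferentiableAt ℝ w a)
    (hwa : w a = 0) (hc : sin (a - c) = 0) :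
    ContinuousAt (fun t => w t ^ 2 * (cos (t - c) / sin (t - c))) a := by
  have hcos : cos (a - c) ≠ 0 := by
    rcases sin_eq_zero_iff_cos_eq.1 hc with h | h <;> norm_num [h]
  have hsin : HasDerivAt (fun t => sin (t - c)) (cos (a - c)) a :=
    (hasDerivAt_sin _).comp_sub_const a c
  have hquot : Tendsto (fun t => w t / sin (t - c)) (𝓝[≠] a) (𝓝 (deriv w a / cos (a - c))) := by
    refine ((hasDerivAt_iff_tendsto_slope.1 hw.hasDerivAt).div
      (hasDerivAt_iff_tendsto_slope.1 hsin) hcos).congr' ?_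
    filter_upwards [self_mem_nhdsWithin] with t ht
    simp only [Pi.div_apply, slope_def_field, hwa, hc, sub_zero]
    exact div_div_div_cancel_right₀ (sub_ne_zero.2 ht) _ _
  have hprod : Tendsto (fun t => w t * cos (t - c)) (𝓝[≠] a) (𝓝 0) := by
    have h : ContinuousAt (fun t => w t * cos (t - c)) a := hw.continuousAt.mul (by fun_prop)
    simpa [ContinuousAt, hwa] using h.tendsto.mono_left nhdsWithin_le_nhds
  rw [continuousAt_iff_punctured_nhds, hwa, zero_pow two_ne_zero, zero_mul]
  refine (zero_mul (deriv w a / cos (a - c)) ▸ hprod.mul hquot).congr fun t => ?_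
  ring

namespace Defocusing

/-- The force of the defocusing cubic oscillator `w'' = -w + w³`. -/
def force (x : ℝ) : ℝ := -x + x ^ 3

theorem contDiff_force : ContDiff ℝ 1 force := by
  unfold force
  fun_prop

theorem odd_force : force.Odd := fun x => by
  simp only [force]
  ring

variable {w : ℝ → ℝ}

theorem isNewtonSolution_sqrt_mul {ε : ℝ} (hε : 0 ≤ ε)
    (hw : IsNewtonSolution (fun x => -x + ε * x ^ 3) w) :
    IsNewtonSolution force fun t => √ε * w t := by
  refine .of_hasDerivAt (fun t => (hw.hasDerivAt t).const_mul _)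
    fun t => ((hw.hasDerivAt_deriv t).const_mul _).congr_deriv ?_
  rw [force]
  linear_combination -√ε * w t ^ 3 * sq_sqrt hε

/-- `w' (w - 1 / w)` is periodic, and nondecreasing because its derivative is
`w'² (1 + 1 / w²) + (w² - 1)²`. -/
theorem deriv_eq_zero_of_forall_ne_zero {T : ℝ} (hT : 0 < T) (hw : IsNewtonSolution force w)
    (hper : Function.Periodic w T) (hw₀ : ∀ t, w t ≠ 0) (t : ℝ) : deriv w t = 0 := by
  have hg (t : ℝ) : HasDerivAt (fun t => deriv w t * (w t - (w t)⁻¹))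
      (deriv w t ^ 2 * (1 + (w t ^ 2)⁻¹) + (w t ^ 2 - 1) ^ 2) t := by
    refine ((hw.hasDerivAt_deriv t).mul
      ((hw.hasDerivAt t).sub ((hw.hasDerivAt t).inv (hw₀ t)))).congr_deriv ?_
    have := hw₀ t
    simp only [force, Pi.sub_apply, Pi.inv_apply]
    field_simp
    ring
  have hends : deriv w (t - T) = deriv w (t + T) := by
    simpa only [← deriv_comp_add_const, ← deriv_comp_sub_const] using
      congrArg (deriv · t) (funext fun s => (hper.sub_eq s).trans (hper s).symm)
  have key := eq_zero_of_hasDerivAt_nonneg_of_eq (a := t - T) (b := t + T)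
    (fun s _ => (hg s).continuousAt.continuousWithinAt) (fun s _ => hg s)
    (fun s _ => by positivity) (by simp only [hends, hper.sub_eq, hper t]) t (by simpa using hT)
  have hsq : deriv w t ^ 2 * (1 + (w t ^ 2)⁻¹) = 0 :=
    ((add_eq_zero_iff_of_nonneg (by positivity) (by positivity)).1 key).1
  exact pow_eq_zero_iff two_ne_zero |>.1 ((mul_eq_zero.1 hsq).resolve_right (by positivity))

/-- Picone's identity against `sin`: `w w' - w² cot (t - a)` vanishes at `a` and `a + π`, and is
nondecreasing because its derivative is `(w' - w cot (t - a))² + w⁴`. -/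
theorem eq_zero_between_zeros (hw : IsNewtonSolution force w) {a : ℝ} (ha : w a = 0)
    (ha' : w (a + π) = 0) : ∀ t ∈ Ioo a (a + π), w t = 0 := by
  have hsin {t : ℝ} (ht : t ∈ Ioo a (a + π)) : sin (t - a) ≠ 0 :=
    (sin_pos_of_pos_of_lt_pi (by linarith [ht.1]) (by linarith [ht.2])).ne'
  have hg {t : ℝ} (ht : t ∈ Ioo a (a + π)) :
      HasDerivAt (fun t => w t * deriv w t - w t ^ 2 * (cos (t - a) / sin (t - a)))
        ((deriv w t - w t * (cos (t - a) / sin (t - a))) ^ 2 + w t ^ 4) t := by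
    have hcot := ((hasDerivAt_cos (t - a)).comp_sub_const t a).div
      ((hasDerivAt_sin (t - a)).comp_sub_const t a) (hsin ht)
    refine (((hw.hasDerivAt t).mul (hw.hasDerivAt_deriv t)).sub
      (((hw.hasDerivAt t).pow 2).mul hcot)).congr_deriv ?_
    have := hsin ht
    simp only [force, Pi.div_apply, Pi.pow_apply]
    field_simp
    ring
  have hcont : ContinuousOn (fun t => w t * deriv w t - w t ^ 2 * (cos (t - a) / sin (t - a)))
      (Icc a (a + π)) := by
    have hd (t : ℝ) : DifferentiableAt ℝ w t := (hw.hasDerivAt t).differentiableAt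
    refine (hw.continuous.mul hw.continuous_deriv).continuousOn.sub fun t ht => ?_
    refine ContinuousAt.continuousWithinAt ?_
    rcases eq_endpoints_or_mem_Ioo_of_mem_Icc ht with rfl | rfl | ht
    · exact continuousAt_sq_mul_cos_div_sin (hd _) ha (by simp)
    · exact continuousAt_sq_mul_cos_div_sin (hd _) ha' (by simp)
    · have := hsin ht
      have := hw.continuous
      fun_prop (disch := assumption)
  intro t ht
  have key := eq_zero_of_hasDerivAt_nonneg_of_eq hcont (fun t => hg) (fun t _ => by positivity)
    (by simp [ha, ha']) t ht
  have hpow : w t ^ 4 = 0 := ((add_eq_zero_iff_of_nonneg (by positivity) (by positivity)).1 key).2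
  exact pow_eq_zero_iff four_ne_zero |>.1 hpow

theorem eq_zero_of_periodic_of_eq_zero (hw : IsNewtonSolution force w)
    (hper : Function.Periodic w (2 * π)) {a : ℝ} (ha : w a = 0) : w = 0 := by
  have hodd : w = fun t => -w (2 * a - t) :=
    hw.eq_of_initial_data contDiff_force ((hw.comp_const_sub (2 * a)).neg odd_force) (t₀ := a)
      (by simp [two_mul, ha]) (by simp [two_mul, deriv_comp_const_sub])
  have hπ : w (a + π) = 0 := by
    have h : w (a + π) = -w (a - π) := by
      convert congrFun hodd (a + π) using 3
      ring
    have hsub : w (a - π) = w (a + π) := by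
      rw [← hper (a - π)]
      congr 1
      ring
    linarith
  have hmem : a + π / 2 ∈ Ioo a (a + π) := by constructor <;> linarith [pi_pos]
  have hloc : w =ᶠ[𝓝 (a + π / 2)] fun _ => 0 := by
    filter_upwards [Ioo_mem_nhds hmem.1 hmem.2] using eq_zero_between_zeros hw ha hπ
  exact hw.eq_of_initial_data contDiff_force (.const (c := 0) (by simp [force])) hloc.eq_of_nhds
    hloc.deriv_eq

theorem eq_const_of_periodic (hw : IsNewtonSolution force w)
    (hper : Function.Periodic w (2 * π)) : ∃ c, w = fun _ => c := by
  by_cases hw₀ : ∀ t, w t ≠ 0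
  · refine ⟨w 0, funext fun t => is_const_of_deriv_eq_zero (fun t => ?_) ?_ t 0⟩
    · exact (hw.hasDerivAt t).differentiableAt
    · exact deriv_eq_zero_of_forall_ne_zero two_pi_pos hw hper hw₀
  · push Not at hw₀
    obtain ⟨a, ha⟩ := hw₀
    exact ⟨0, eq_zero_of_periodic_of_eq_zero hw hper ha⟩

end Defocusing

/-! ### The spherical Laplacian in polar coordinates -/

section SecondOrderChainRule

variable {E F : Type*} [NormedAddCommGroup E] [NormedSpace ℝ E]
  [NormedAddCommGroup F] [NormedSpace ℝ F] {U : E → F} {γ γ' : ℝ → E} {t : ℝ}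

theorem deriv_comp_curve {v : E} (hU : DifferentiableAt ℝ U (γ t)) (hγ : HasDerivAt γ v t) :
    deriv (fun t => U (γ t)) t = fderiv ℝ U (γ t) v :=
  (hU.hasFDerivAt.comp_hasDerivAt t hγ).deriv

theorem deriv_deriv_comp_curve {γ'' : E} (hU : ContDiffAt ℝ 2 U (γ t))
    (hγ : ∀ t, HasDerivAt γ (γ' t) t) (hγ' : HasDerivAt γ' γ'' t) :
    deriv (deriv fun t => U (γ t)) t =
      iteratedFDeriv ℝ 2 U (γ t) ![γ' t, γ' t] + fderiv ℝ U (γ t) γ'' := by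
  have hU' : HasFDerivAt (fderiv ℝ U) (fderiv ℝ (fderiv ℝ U) (γ t)) (γ t) :=
    ((hU.fderiv_right (m := 1) (by norm_num)).differentiableAt one_ne_zero).hasFDerivAt
  have hderiv : deriv (fun t => U (γ t)) =ᶠ[𝓝 t] fun t => fderiv ℝ U (γ t) (γ' t) := by
    filter_upwards [(hγ t).continuousAt.eventually (hU.eventually (by simp))] with s hs
    exact deriv_comp_curve (hs.differentiableAt two_ne_zero) (hγ s)
  rw [hderiv.deriv_eq, iteratedFDeriv_two_apply]
  exact ((hU'.comp_hasDerivAt t (hγ t)).clm_apply hγ').deriv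

end SecondOrderChainRule

section RadialExtension

variable {u v : S2 → ℝ} {x : S2}

theorem norm_coe_S2 (x : S2) : ‖(x : E3)‖ = 1 := mem_sphere_zero_iff_norm.1 x.2

theorem coe_S2_ne_zero (x : S2) : (x : E3) ≠ 0 := ne_zero_of_mem_unit_sphere x

theorem radialExtension_smul (u : S2 → ℝ) (x : S2) {t : ℝ} (ht : 0 < t) :
    radialExtension u (t • (x : E3)) = u x := by
  rw [radialExtension, dif_neg (smul_ne_zero ht.ne' (coe_S2_ne_zero x))]
  congr 1
  ext1
  simp only [norm_smul, norm_coe_S2, mul_one, norm_of_nonneg ht.le]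
  exact inv_smul_smul₀ ht.ne' _

theorem radialExtension_coe (u : S2 → ℝ) (x : S2) : radialExtension u x = u x := by
  simpa only [one_smul] using radialExtension_smul u x one_pos

theorem radialExtension_congr (h : u =ᶠ[𝓝 x] v) :
    radialExtension u =ᶠ[𝓝 (x : E3)] radialExtension v := by
  obtain ⟨V, hV, hVuv⟩ := mem_nhds_induced _ _ _ |>.1 h
  have hcont : ContinuousAt (fun y : E3 => ‖y‖⁻¹ • y) x :=
    (continuousAt_id.norm.inv₀ (norm_ne_zero_iff.2 (coe_S2_ne_zero x))).smul continuousAt_id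
  have hVx : V ∈ 𝓝 (‖(x : E3)‖⁻¹ • (x : E3)) := by rwa [norm_coe_S2, inv_one, one_smul]
  filter_upwards [hcont hVx, isOpen_ne.mem_nhds (coe_S2_ne_zero x)] with y hyV hy
  simp only [radialExtension, dif_neg hy]
  exact hVuv hyV

theorem hasDerivAt_ray (x : E3) (t : ℝ) : HasDerivAt (fun t : ℝ => t • x) x t := by
  simpa only [one_smul, id] using (hasDerivAt_id t).smul_const x

theorem fderiv_radialExtension_ray (hU : DifferentiableAt ℝ (radialExtension u) x) :
    fderiv ℝ (radialExtension u) x x = 0 := by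
  have hray : (fun t : ℝ => radialExtension u (t • (x : E3))) =ᶠ[𝓝 1] fun _ => u x := by
    filter_upwards [lt_mem_nhds one_pos] with t ht using radialExtension_smul u x ht
  have key := deriv_comp_curve (by rwa [one_smul]) (hasDerivAt_ray x 1)
  rw [hray.deriv_eq, deriv_const, one_smul] at key
  exact key.symm

theorem iteratedFDeriv_radialExtension_ray (hU : ContDiffAt ℝ 2 (radialExtension u) x) :
    iteratedFDeriv ℝ 2 (radialExtension u) x ![(x : E3), (x : E3)] = 0 := by
  have hray : (fun t : ℝ => radialExtension u (t • (x : E3))) =ᶠ[𝓝 1] fun _ => u x := by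
    filter_upwards [lt_mem_nhds one_pos] with t ht using radialExtension_smul u x ht
  have key := deriv_deriv_comp_curve (by rwa [one_smul]) (hasDerivAt_ray x)
    (hasDerivAt_const 1 (x : E3))
  rw [hray.deriv.deriv_eq, deriv_const', deriv_const, one_smul, map_zero, add_zero] at key
  exact key.symm

end RadialExtension

section PolarFrame

theorem hasDerivAt_vec3 {a b c : ℝ → ℝ} {a' b' c' t : ℝ} (ha : HasDerivAt a a' t)
    (hb : HasDerivAt b b' t) (hc : HasDerivAt c c' t) :
    HasDerivAt (fun t => (!₂[a t, b t, c t] : E3)) !₂[a', b', c'] t := by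
  have h : HasDerivAt (fun t => ![a t, b t, c t]) ![a', b', c'] t := by
    rw [hasDerivAt_pi]
    intro i
    fin_cases i
    exacts [ha, hb, hc]
  exact (PiLp.hasFDerivAt_toLp 2 _).comp_hasDerivAt t h

theorem inner_vec3 (a b c a' b' c' : ℝ) :
    inner ℝ (!₂[a, b, c] : E3) !₂[a', b', c'] = a * a' + b * b' + c * c' := by
  simp only [PiLp.inner_apply, Fin.sum_univ_three]
  simp
  ring

/-- The unit tangent vector at `polarPoint r θ` to the meridian of longitude `θ`. -/
noncomputable def meridianTangent (r θ : ℝ) : E3 :=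
  !₂[cos r * cos θ, cos r * sin θ, -sin r]

/-- The unit tangent vector at `polarPoint r θ` to the parallel through it, which does not depend
on `r`. -/
noncomputable def parallelTangent (θ : ℝ) : E3 := !₂[-sin θ, cos θ, 0]

variable (r θ : ℝ)

theorem hasDerivAt_polarPoint_radius :
    HasDerivAt (fun r => (polarPoint r θ : E3)) (meridianTangent r θ) r :=
  hasDerivAt_vec3 ((hasDerivAt_sin r).mul_const _) ((hasDerivAt_sin r).mul_const _)
    (hasDerivAt_cos r)

theorem hasDerivAt_meridianTangent :
    HasDerivAt (fun r => meridianTangent r θ) (-(polarPoint r θ : E3)) r := by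
  refine (hasDerivAt_vec3 ((hasDerivAt_cos r).mul_const _) ((hasDerivAt_cos r).mul_const _)
    (hasDerivAt_sin r).neg).congr_deriv ?_
  ext i
  fin_cases i <;> simp [polarPoint]

theorem hasDerivAt_polarPoint_angle :
    HasDerivAt (fun θ => (polarPoint r θ : E3)) (sin r • parallelTangent θ) θ := by
  refine (hasDerivAt_vec3 ((hasDerivAt_cos θ).const_mul _) ((hasDerivAt_sin θ).const_mul _)
    (hasDerivAt_const θ (cos r))).congr_deriv ?_
  ext i
  fin_cases i <;> simp [parallelTangent]

theorem hasDerivAt_parallelTangent :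
    HasDerivAt parallelTangent (-(sin r • (polarPoint r θ : E3) + cos r • meridianTangent r θ))
      θ := by
  refine (hasDerivAt_vec3 (hasDerivAt_sin θ).neg (hasDerivAt_cos θ)
    (hasDerivAt_const θ (0 : ℝ))).congr_deriv ?_
  have hr := sin_sq_add_cos_sq r
  ext i
  fin_cases i <;> simp [polarPoint, meridianTangent]
  · linear_combination cos θ * hr
  · linear_combination sin θ * hr
  · ring

theorem orthonormal_polarFrame :
    Orthonormal ℝ ![(polarPoint r θ : E3), meridianTangent r θ, parallelTangent θ] := by
  have hr := sin_sq_add_cos_sq r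
  have hθ := sin_sq_add_cos_sq θ
  rw [orthonormal_iff_ite]
  intro i j
  fin_cases i <;> fin_cases j <;> refine (inner_vec3 _ _ _ _ _ _).trans ?_ <;> norm_num
  · linear_combination hr + sin r ^ 2 * hθ
  · linear_combination sin r * cos r * hθ
  · ring
  · linear_combination sin r * cos r * hθ
  · linear_combination hr + cos r ^ 2 * hθ
  · ring
  · ring
  · ring
  · linear_combination hθ

end PolarFrame

section PolarLaplacian

variable {u : S2 → ℝ} {r θ : ℝ}

theorem deriv_comp_polarPoint_radius
    (hU : DifferentiableAt ℝ (radialExtension u) (polarPoint r θ : E3)) :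
    deriv (fun r => u (polarPoint r θ)) r =
      fderiv ℝ (radialExtension u) (polarPoint r θ : E3) (meridianTangent r θ) := by
  simp only [← radialExtension_coe u]
  exact deriv_comp_curve (γ := fun r => (polarPoint r θ : E3)) hU
    (hasDerivAt_polarPoint_radius r θ)

theorem deriv_deriv_comp_polarPoint_radius
    (hU : ContDiffAt ℝ 2 (radialExtension u) (polarPoint r θ : E3)) :
    deriv (deriv fun r => u (polarPoint r θ)) r =
      iteratedFDeriv ℝ 2 (radialExtension u) (polarPoint r θ : E3)
        ![meridianTangent r θ, meridianTangent r θ] := by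
  simp only [← radialExtension_coe u]
  rw [deriv_deriv_comp_curve (γ := fun r => (polarPoint r θ : E3)) hU
    (hasDerivAt_polarPoint_radius · θ) (hasDerivAt_meridianTangent r θ), map_neg,
    fderiv_radialExtension_ray (hU.differentiableAt two_ne_zero), neg_zero, add_zero]

theorem deriv_deriv_comp_polarPoint_angle
    (hU : ContDiffAt ℝ 2 (radialExtension u) (polarPoint r θ : E3)) :
    deriv (deriv fun θ => u (polarPoint r θ)) θ =
      sin r ^ 2 * iteratedFDeriv ℝ 2 (radialExtension u) (polarPoint r θ : E3)
        ![parallelTangent θ, parallelTangent θ] -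
      sin r * cos r *
        fderiv ℝ (radialExtension u) (polarPoint r θ : E3) (meridianTangent r θ) := by
  simp only [← radialExtension_coe u]
  rw [deriv_deriv_comp_curve (γ := fun θ => (polarPoint r θ : E3)) hU
    (hasDerivAt_polarPoint_angle r) ((hasDerivAt_parallelTangent r θ).const_smul (sin r))]
  simp only [iteratedFDeriv_two_apply, Matrix.cons_val_zero, Matrix.cons_val_one, map_smul, map_neg,
    map_add, _root_.smul_apply, smul_eq_mul,
    fderiv_radialExtension_ray (hU.differentiableAt two_ne_zero)]
  ring

theorem sphereLaplacian_eq_iteratedFDeriv_tangents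
    (hU : ContDiffAt ℝ 2 (radialExtension u) (polarPoint r θ : E3)) :
    sphereLaplacian u (polarPoint r θ) =
      iteratedFDeriv ℝ 2 (radialExtension u) (polarPoint r θ : E3)
        ![meridianTangent r θ, meridianTangent r θ] +
      iteratedFDeriv ℝ 2 (radialExtension u) (polarPoint r θ : E3)
        ![parallelTangent θ, parallelTangent θ] := by
  have hframe := orthonormal_polarFrame r θ
  rw [sphereLaplacian, InnerProductSpace.laplacian_eq_iteratedFDeriv_orthonormalBasis _
    (OrthonormalBasis.mk hframe (hframe.linearIndependent.span_eq_top_of_card_eq_finrank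
      (by simp)).ge)]
  simp only [OrthonormalBasis.coe_mk, Fin.sum_univ_three, Matrix.cons_val]
  rw [iteratedFDeriv_radialExtension_ray hU, zero_add]

theorem sphereLaplacian_polarPoint (hr : sin r ≠ 0)
    (hU : ContDiffAt ℝ 2 (radialExtension u) (polarPoint r θ : E3)) :
    sphereLaplacian u (polarPoint r θ) =
      deriv (deriv fun r => u (polarPoint r θ)) r +
      cos r / sin r * deriv (fun r => u (polarPoint r θ)) r +
      deriv (deriv fun θ => u (polarPoint r θ)) θ / sin r ^ 2 := by
  rw [sphereLaplacian_eq_iteratedFDeriv_tangents hU, deriv_deriv_comp_polarPoint_radius hU,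
    deriv_comp_polarPoint_radius (hU.differentiableAt two_ne_zero),
    deriv_deriv_comp_polarPoint_angle hU]
  field_simp
  ring

end PolarLaplacian

section Horizontal

/-- The orthogonal projection of `ℝ³` to the plane of the equator, identified with `ℂ`. -/
noncomputable def horizontal (x : E3) : ℂ := (x 0 : ℂ) + x 1 * Complex.I

theorem contDiff_horizontal {n : WithTop ℕ∞} : ContDiff ℝ n horizontal :=
  (Complex.ofRealCLM.contDiff.comp (contDiff_piLp_apply 2)).add
    ((Complex.ofRealCLM.contDiff.comp (contDiff_piLp_apply 2)).mul contDiff_const)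

theorem horizontal_smul (t : ℝ) (x : E3) : horizontal (t • x) = t * horizontal x := by
  simp only [horizontal, PiLp.smul_apply, smul_eq_mul, Complex.ofReal_mul]
  ring

theorem horizontal_polarPoint (r θ : ℝ) :
    horizontal (polarPoint r θ) = (sin r : ℝ) * (Complex.cos θ + Complex.sin θ * Complex.I) := by
  simp [horizontal, polarPoint]
  ring

theorem norm_horizontal_polarPoint (r θ : ℝ) : ‖horizontal (polarPoint r θ)‖ = |sin r| := by
  rw [horizontal_polarPoint, norm_mul, Complex.cos_add_sin_I, Complex.norm_exp_ofReal_mul_I,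
    mul_one, Complex.norm_real, norm_eq_abs]

theorem norm_horizontal_sq_add (x : E3) : ‖horizontal x‖ ^ 2 + x 2 ^ 2 = ‖x‖ ^ 2 := by
  rw [EuclideanSpace.norm_sq_eq, Fin.sum_univ_three, horizontal, ← Complex.normSq_eq_norm_sq,
    Complex.normSq_add_mul_I]
  simp only [norm_eq_abs, sq_abs]

theorem exists_eq_polarPoint (x : S2) : ∃ r ∈ Icc 0 π, ∃ θ, x = polarPoint r θ := by
  obtain ⟨z, hz⟩ : ∃ z, z = horizontal x := ⟨_, rfl⟩
  obtain ⟨y, hre, him⟩ : ∃ y : ℂ, y.re = x.1 2 ∧ y.im = ‖z‖ := ⟨⟨_, _⟩, rfl, rfl⟩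
  have hnorm : ‖y‖ = 1 := by
    have h := norm_horizontal_sq_add x
    rw [norm_coe_S2, one_pow, ← hz] at h
    rw [← sq_eq_sq₀ (norm_nonneg _) zero_le_one, Complex.sq_norm, Complex.normSq_apply, hre,
      him]
    linear_combination h
  have hsin : sin y.arg = ‖z‖ := by
    rw [← him, ← Complex.norm_mul_sin_arg y, hnorm, one_mul]
  have hcos : cos y.arg = x.1 2 := by
    rw [← hre, ← Complex.norm_mul_cos_arg y, hnorm, one_mul]
  refine ⟨y.arg, ⟨Complex.arg_nonneg_iff.2 (by simp [him]), Complex.arg_le_pi y⟩, z.arg, ?_⟩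
  ext i
  fin_cases i <;> simp [polarPoint, hsin, hcos, Complex.norm_mul_cos_arg, Complex.norm_mul_sin_arg]
    <;> simp [hz, horizontal]

theorem mem_awayFromPoles_iff {Ω : Set S2} {x : S2} :
    x ∈ awayFromPoles Ω ↔ x ∈ Ω ∧ horizontal x ≠ 0 := by
  refine ⟨?_, fun ⟨hx, hne⟩ => ?_⟩
  · rintro ⟨r, hr, θ, rfl, hx⟩
    have hsin := sin_pos_of_mem_Ioo hr
    exact ⟨hx, norm_pos_iff.1 (by rw [norm_horizontal_polarPoint]; positivity)⟩
  · obtain ⟨r, hr, θ, rfl⟩ := exists_eq_polarPoint x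
    rw [← norm_ne_zero_iff, norm_horizontal_polarPoint, abs_ne_zero] at hne
    refine ⟨r, ⟨hr.1.lt_of_ne ?_, hr.2.lt_of_ne ?_⟩, θ, rfl, hx⟩ <;> rintro rfl <;> simp at hne

theorem isOpen_awayFromPoles {Ω : Set S2} (hΩ : IsOpen Ω) : IsOpen (awayFromPoles Ω) := by
  have hcont : Continuous fun x : S2 => horizontal x :=
    (contDiff_horizontal (n := 0)).continuous.comp continuous_subtype_val
  rw [show awayFromPoles Ω = Ω ∩ {x | horizontal x ≠ 0} from Set.ext fun _ => mem_awayFromPoles_iff]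
  exact hΩ.inter (isOpen_ne_fun hcont continuous_const)

end Horizontal

section AngularProfile

variable {w : ℝ → ℝ}

theorem eq_of_coe_angle_eq (hw : Function.Periodic w (2 * π)) {a b : ℝ}
    (h : (a : Angle) = b) : w a = w b :=
  congrArg hw.lift h

theorem contDiffAt_comp_arg {n : WithTop ℕ∞} (hw : ContDiff ℝ n w)
    (hper : Function.Periodic w (2 * π)) {z₀ : ℂ} (hz₀ : z₀ ≠ 0) :
    ContDiffAt ℝ n (fun z => w z.arg) z₀ := by
  have hlog : ContDiffAt ℝ n (fun z => Complex.log (z / z₀)) z₀ := by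
    refine ContDiffAt.comp z₀ ((Complex.contDiffAt_log ?_).restrict_scalars ℝ)
      (contDiffAt_id.mul contDiffAt_const)
    simp [hz₀]
  have harg : ContDiffAt ℝ n (fun z => z₀.arg + (Complex.log (z / z₀)).im) z₀ :=
    contDiffAt_const.add (Complex.imCLM.contDiff.contDiffAt.comp z₀ hlog)
  refine (hw.contDiffAt.comp z₀ harg).congr_of_eventuallyEq ?_
  filter_upwards [isOpen_ne.mem_nhds hz₀] with z hz
  refine eq_of_coe_angle_eq hper ?_
  simp only
  rw [Complex.log_im, Angle.coe_add, ← Complex.arg_mul_coe_angle hz₀ (div_ne_zero hz hz₀),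
    mul_div_cancel₀ _ hz₀]

/-- The function `w(θ) / sin r` on the sphere, for a `2π`-periodic `w`; its value at the poles
is `0`. -/
noncomputable def angularProfile (w : ℝ → ℝ) (x : S2) : ℝ :=
  w (horizontal x).arg / ‖horizontal x‖

theorem angularProfile_polarPoint (hper : Function.Periodic w (2 * π)) {r : ℝ} (hr : r ∈ Ioo 0 π)
    (θ : ℝ) : angularProfile w (polarPoint r θ) = w θ / sin r := by
  have hsin := sin_pos_of_mem_Ioo hr
  rw [angularProfile, norm_horizontal_polarPoint, abs_of_pos hsin, horizontal_polarPoint]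
  congr 1
  refine eq_of_coe_angle_eq hper ?_
  simpa using Complex.arg_mul_cos_add_sin_mul_I_coe_angle hsin (θ : Angle)

theorem radialExtension_angularProfile (w : ℝ → ℝ) {x : E3} (hx : x ≠ 0) :
    radialExtension (angularProfile w) x = w (horizontal x).arg * (‖x‖ / ‖horizontal x‖) := by
  have hnorm : 0 < ‖x‖⁻¹ := by positivity
  rw [radialExtension, dif_neg hx, angularProfile, horizontal_smul, norm_mul,
    Complex.arg_real_mul _ hnorm, Complex.norm_real, norm_of_nonneg hnorm.le]
  field_simp

theorem contDiffAt_radialExtension_angularProfile {n : WithTop ℕ∞} (hw : ContDiff ℝ n w)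
    (hper : Function.Periodic w (2 * π)) {x : E3} (hx : horizontal x ≠ 0) :
    ContDiffAt ℝ n (radialExtension (angularProfile w)) x := by
  have hx₀ : x ≠ 0 := by
    rintro rfl
    simp [horizontal] at hx
  have hhor := (contDiff_horizontal (n := n)).contDiffAt (x := x)
  have hsmooth : ContDiffAt ℝ n
      (fun x => w (horizontal x).arg * (‖x‖ / ‖horizontal x‖)) x :=
    ((contDiffAt_comp_arg hw hper hx).comp x hhor).mul
      ((contDiffAt_norm ℝ hx₀).div (hhor.norm ℝ hx) (norm_ne_zero_iff.2 hx))
  refine hsmooth.congr_of_eventuallyEq ?_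
  filter_upwards [isOpen_ne.mem_nhds hx₀] with y hy using radialExtension_angularProfile w hy

end AngularProfile

section AxialSymmetry

/-- `Ω` is invariant under all rotations about the vertical axis. -/
def IsAxiallySymmetric (Ω : Set S2) : Prop :=
  ∀ α : ℝ, ∀ x ∈ Ω, axialRotation α x ∈ Ω

theorem IsRotSymmDomain.isAxiallySymmetric {Ω : Set S2} (hΩ : IsRotSymmDomain Ω) :
    IsAxiallySymmetric Ω :=
  hΩ.rotation_mem

/-- The polar radii of the points of `Ω` on the meridian `θ = 0`, without the poles. -/
def radii (Ω : Set S2) : Set ℝ := {r | r ∈ Ioo 0 π ∧ polarPoint r 0 ∈ Ω}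

variable {Ω : Set S2} {r : ℝ}

theorem axialRotation_polarPoint (α r θ : ℝ) :
    axialRotation α (polarPoint r θ) = polarPoint r (θ + α) := by
  ext i
  fin_cases i <;> simp [axialRotation, polarPoint, cos_add, sin_add] <;> ring

theorem sin_pos_of_mem_radii (hr : r ∈ radii Ω) : 0 < sin r := sin_pos_of_mem_Ioo hr.1

theorem continuous_polarPoint_radius (θ : ℝ) : Continuous fun r => polarPoint r θ :=
  Continuous.subtype_mk (continuous_iff_continuousAt.2 fun r =>
    (hasDerivAt_polarPoint_radius r θ).continuousAt) _

theorem isOpen_radii (hΩ : IsOpen Ω) : IsOpen (radii Ω) :=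
  isOpen_Ioo.inter (hΩ.preimage (continuous_polarPoint_radius 0))

namespace IsAxiallySymmetric

theorem mem_radii_iff (hΩ : IsAxiallySymmetric Ω) (θ : ℝ) :
    r ∈ radii Ω ↔ r ∈ Ioo 0 π ∧ polarPoint r θ ∈ Ω := by
  refine and_congr_right' ⟨fun h => ?_, fun h => ?_⟩
  · simpa [axialRotation_polarPoint] using hΩ θ _ h
  · simpa [axialRotation_polarPoint] using hΩ (-θ) _ h

theorem polarPoint_mem_awayFromPoles (hΩ : IsAxiallySymmetric Ω) (hr : r ∈ radii Ω) (θ : ℝ) :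
    polarPoint r θ ∈ awayFromPoles Ω :=
  ⟨r, hr.1, θ, rfl, ((hΩ.mem_radii_iff θ).1 hr).2⟩

theorem nonempty_radii (hΩ : IsAxiallySymmetric Ω) (hopen : IsOpen Ω) (hne : Ω.Nonempty) :
    (radii Ω).Nonempty := by
  obtain ⟨x, hx⟩ := hne
  obtain ⟨r, hr, θ, rfl⟩ := exists_eq_polarPoint x
  rw [← closure_Ioo pi_pos.ne] at hr
  obtain ⟨s, hsΩ, hs⟩ :=
    mem_closure_iff.1 hr _ (hopen.preimage (continuous_polarPoint_radius θ)) hx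
  exact ⟨s, (hΩ.mem_radii_iff θ).2 ⟨hs, hsΩ⟩⟩

/-- The radii of `Ω` are the arguments of the cosines forming the interval of heights of `Ω`. -/
theorem isPreconnected_radii (hΩ : IsAxiallySymmetric Ω) (hconn : IsPreconnected Ω) :
    IsPreconnected (radii Ω) := by
  have hheights : OrdConnected ((fun x : S2 => x.1 2) '' Ω) :=
    (hconn.image _ (by fun_prop)).ordConnected
  refine (ordConnected_def.2 fun a ha b hb r hr => ?_ : (radii Ω).OrdConnected).isPreconnected
  have hr' : r ∈ Ioo 0 π := ⟨ha.1.1.trans_le hr.1, hr.2.trans_lt hb.1.2⟩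
  have hcos : cos r ∈ Icc (cos b) (cos a) :=
    ⟨cos_le_cos_of_nonneg_of_le_pi hr'.1.le hb.1.2.le hr.2,
      cos_le_cos_of_nonneg_of_le_pi ha.1.1.le hr'.2.le hr.1⟩
  obtain ⟨x, hx, hxr⟩ := hheights.out (mem_image_of_mem _ hb.2) (mem_image_of_mem _ ha.2) hcos
  obtain ⟨s, hs, θ, rfl⟩ := exists_eq_polarPoint x
  obtain rfl : s = r := injOn_cos hs (Ioo_subset_Icc_self hr') hxr
  exact (hΩ.mem_radii_iff θ).2 ⟨hr', hx⟩

end IsAxiallySymmetric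

end AxialSymmetry

/-! ### Separation of variables -/

theorem eq_of_abs_eq_of_ne_zero {X : Type*} [TopologicalSpace X] {s : Set X}
    (hs : IsPreconnected s) {f : X → ℝ} (hf : ContinuousOn f s) {m : ℝ}
    (hm : ∀ x ∈ s, f x ≠ 0 → |f x| = m) {x y : X} (hx : x ∈ s) (hy : y ∈ s) : f x = f y := by
  have hfin : ({0, m, -m} : Set ℝ).Finite := Set.toFinite _
  refine hs.constant_of_mapsTo hfin.isDiscrete hf (fun z hz => ?_) hx hy
  by_cases hz₀ : f z = 0
  · exact .inl hz₀
  · exact .inr (eq_or_eq_neg_of_abs_eq (hm z hz hz₀))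

theorem eq_zero_of_mul_add_mul_rpow_eq_zero {w : ℝ → ℝ} (hw : Continuous w) {a b : ℝ}
    (hab : w a ≠ w b) {p α β : ℝ} (hp : p ≠ 0)
    (h : ∀ θ, α * w θ + β * (w θ * |w θ| ^ p) = 0) : α = 0 ∧ β = 0 := by
  obtain ⟨θ₀, hθ₀⟩ : ∃ θ, w θ ≠ 0 := by
    by_contra! hw₀
    exact hab (by rw [hw₀, hw₀])
  have hα {θ : ℝ} (hθ : w θ ≠ 0) : α + β * |w θ| ^ p = 0 :=
    mul_left_cancel₀ hθ (by linear_combination h θ)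
  have hβ : β = 0 := by
    by_contra hβ
    refine hab (eq_of_abs_eq_of_ne_zero isPreconnected_univ hw.continuousOn (m := |w θ₀|)
      (fun θ _ hθ => ?_) trivial trivial)
    refine (rpow_left_inj (abs_nonneg _) (abs_nonneg _) hp).1 (mul_left_cancel₀ hβ ?_)
    linear_combination hα hθ - hα hθ₀
  exact ⟨by simpa [hβ] using hα hθ₀, hβ⟩

theorem not_eventuallyEq_cos_sq_const (r c : ℝ) : ¬ (fun x => cos x ^ 2) =ᶠ[𝓝 r] fun _ => c := by
  intro h
  have hderiv : deriv (fun x => cos x ^ 2) = fun x => -sin (2 * x) := funext fun x => by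
    refine ((hasDerivAt_cos x).pow 2).deriv.trans ?_
    rw [sin_two_mul]
    ring
  have hderiv₂ : deriv (fun x => -sin (2 * x)) r = -2 * cos (2 * r) :=
    (((hasDerivAt_id r).const_mul 2).sin.neg).deriv.trans (by simp; ring)
  have hsin : -sin (2 * r) = 0 := by rw [← congrFun hderiv r, h.deriv_eq, deriv_const]
  have hcos : -2 * cos (2 * r) = 0 := by
    rw [← hderiv₂, ← hderiv, h.deriv.deriv_eq, deriv_const', deriv_const]
  nlinarith [sin_sq_add_cos_sq (2 * r)]

/-- `u(r, θ) = h(r) w(θ)` satisfies `Δ u = ε u|u|^(q-1)`, written in polar coordinates, at the radii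
`r ∈ J`, with `w` not constant. -/
structure IsSeparatedSolution (ε q : ℝ) (J : Set ℝ) (h w : ℝ → ℝ) : Prop where
  differentiableAt : ∀ r ∈ J, DifferentiableAt ℝ h r
  contDiff : ContDiff ℝ 2 w
  exists_ne : ∃ a b, w a ≠ w b
  equation : ∀ r ∈ J, ∀ θ, deriv (deriv h) r * w θ + cos r / sin r * (deriv h r * w θ) +
    h r * deriv (deriv w) θ / sin r ^ 2 = ε * (h r * w θ * |h r * w θ| ^ (q - 1))

/-- The coefficient `A(r)` in the equation `w'' = -A(r) w + ε κ(r) w|w|^(q-1)` that a solution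
`h(r) w(θ)` imposes on its angular factor. -/
noncomputable def linearCoefficient (h : ℝ → ℝ) (r : ℝ) : ℝ :=
  (deriv (deriv h) r + cos r / sin r * deriv h r) * sin r ^ 2 / h r

/-- The coefficient `κ(r)` in the equation `w'' = -A(r) w + ε κ(r) w|w|^(q-1)` that a solution
`h(r) w(θ)` imposes on its angular factor. -/
noncomputable def powerCoefficient (q : ℝ) (h : ℝ → ℝ) (r : ℝ) : ℝ := |h r| ^ (q - 1) * sin r ^ 2

theorem log_powerCoefficient (q : ℝ) {h : ℝ → ℝ} {r : ℝ} (hr : sin r ≠ 0) (hhr : h r ≠ 0) :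
    log (powerCoefficient q h r) = (q - 1) * log (h r) + 2 * log (sin r) := by
  rw [powerCoefficient, log_mul (by positivity) (by positivity), log_rpow (abs_pos.2 hhr), log_abs,
    log_pow, Nat.cast_ofNat]

theorem powerCoefficient_three (h : ℝ → ℝ) (r : ℝ) :
    powerCoefficient 3 h r = (h r * sin r) ^ 2 := by
  rw [powerCoefficient, show (3 : ℝ) - 1 = (2 : ℕ) by norm_num, rpow_natCast, sq_abs, mul_pow]

namespace IsSeparatedSolution

variable {ε q : ℝ} {J : Set ℝ} {h w : ℝ → ℝ} {r s : ℝ}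

theorem deriv_deriv_eq (hs : IsSeparatedSolution ε q J h w) (hr : r ∈ J) (hsin : sin r ≠ 0)
    (hhr : h r ≠ 0) (θ : ℝ) : deriv (deriv w) θ =
      -linearCoefficient h r * w θ + ε * powerCoefficient q h r * (w θ * |w θ| ^ (q - 1)) := by
  have heq := hs.equation r hr θ
  rw [abs_mul, mul_rpow (abs_nonneg _) (abs_nonneg _)] at heq
  simp only [linearCoefficient, powerCoefficient]
  field_simp at heq ⊢
  linear_combination heq

theorem coefficients_eq (hu : IsSeparatedSolution ε q J h w) (hε : ε ≠ 0) (hq : q ≠ 1)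
    (hsin : ∀ r ∈ J, sin r ≠ 0) (hr : r ∈ J) (hhr : h r ≠ 0) (hs : s ∈ J) (hhs : h s ≠ 0) :
    linearCoefficient h r = linearCoefficient h s ∧
      powerCoefficient q h r = powerCoefficient q h s := by
  obtain ⟨a, b, hab⟩ := hu.exists_ne
  obtain ⟨hA, hκ⟩ := eq_zero_of_mul_add_mul_rpow_eq_zero hu.contDiff.continuous hab
    (sub_ne_zero.2 hq) (α := linearCoefficient h s - linearCoefficient h r)
    (β := ε * (powerCoefficient q h r - powerCoefficient q h s)) fun θ => by
      linear_combination hu.deriv_deriv_eq hs (hsin s hs) hhs θ -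
        hu.deriv_deriv_eq hr (hsin r hr) hhr θ
  exact ⟨(sub_eq_zero.1 hA).symm, sub_eq_zero.1 ((mul_eq_zero.1 hκ).resolve_left hε)⟩

theorem eventually_mem (hu : IsSeparatedSolution ε q J h w) (hJ : IsOpen J) (hr : r ∈ J)
    (hhr : h r ≠ 0) : ∀ᶠ s in 𝓝 r, s ∈ J ∧ h s ≠ 0 :=
  (hJ.eventually_mem hr).and ((hu.differentiableAt r hr).continuousAt.eventually_ne hhr)

/-- Logarithmic differentiation of the constant `κ`. -/
theorem deriv_eq (hu : IsSeparatedSolution ε q J h w) (hε : ε ≠ 0) (hq : q ≠ 1) (hJ : IsOpen J)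
    (hsin : ∀ r ∈ J, sin r ≠ 0) (hr : r ∈ J) (hhr : h r ≠ 0) :
    deriv h r = 2 / (1 - q) * (cos r / sin r * h r) := by
  have hlog : (fun s => (q - 1) * log (h s) + 2 * log (sin s)) =ᶠ[𝓝 r]
      fun _ => log (powerCoefficient q h r) := by
    filter_upwards [hu.eventually_mem hJ hr hhr] with s ⟨hs, hhs⟩
    rw [← log_powerCoefficient q (hsin s hs) hhs, (hu.coefficients_eq hε hq hsin hs hhs hr hhr).2]
  have hderiv := (((hu.differentiableAt r hr).hasDerivAt.log hhr).const_mul (q - 1)).add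
    (((hasDerivAt_sin r).log (hsin r hr)).const_mul 2)
  have hzero : (q - 1) * (deriv h r / h r) + 2 * (cos r / sin r) = 0 :=
    hderiv.unique ((hasDerivAt_const r _).congr_of_eventuallyEq hlog)
  have hq' : 1 - q ≠ 0 := sub_ne_zero.2 hq.symm
  have := hsin r hr
  field_simp at hzero ⊢
  linear_combination -hzero

theorem linearCoefficient_eq (hu : IsSeparatedSolution ε q J h w) (hε : ε ≠ 0) (hq : q ≠ 1)
    (hJ : IsOpen J) (hsin : ∀ r ∈ J, sin r ≠ 0) (hr : r ∈ J) (hhr : h r ≠ 0) :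
    linearCoefficient h r =
      ((2 / (1 - q)) ^ 2 + 2 / (1 - q)) * cos r ^ 2 - 2 / (1 - q) := by
  have hderiv : deriv h =ᶠ[𝓝 r] fun s => 2 / (1 - q) * (cos s / sin s * h s) := by
    filter_upwards [hu.eventually_mem hJ hr hhr] with s ⟨hs, hhs⟩
    exact hu.deriv_eq hε hq hJ hsin hs hhs
  have hsin' := hsin r hr
  have hcot := ((hasDerivAt_cos r).div (hasDerivAt_sin r) hsin').mul
    (hu.differentiableAt r hr).hasDerivAt
  have hderiv₂ : deriv (deriv h) r = 2 / (1 - q) * ((-sin r * sin r - cos r * cos r) / sin r ^ 2 *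
      h r + cos r / sin r * deriv h r) :=
    hderiv.deriv_eq.trans (hcot.const_mul _).deriv
  rw [linearCoefficient, hderiv₂, hderiv.eq_of_nhds]
  generalize 2 / (1 - q) = p
  field_simp
  linear_combination -p * sin_sq_add_cos_sq r

theorem eq_three (hu : IsSeparatedSolution ε q J h w) (hε : ε ≠ 0) (hq : q ≠ 1) (hJ : IsOpen J)
    (hsin : ∀ r ∈ J, sin r ≠ 0) (hr : r ∈ J) (hhr : h r ≠ 0) : q = 3 := by
  have hA : (fun s => ((2 / (1 - q)) ^ 2 + 2 / (1 - q)) * cos s ^ 2) =ᶠ[𝓝 r]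
      fun _ => linearCoefficient h r + 2 / (1 - q) := by
    filter_upwards [hu.eventually_mem hJ hr hhr] with s ⟨hs, hhs⟩
    rw [← (hu.coefficients_eq hε hq hsin hs hhs hr hhr).1,
      hu.linearCoefficient_eq hε hq hJ hsin hs hhs]
    ring
  have hp : (2 / (1 - q)) ^ 2 + 2 / (1 - q) = 0 := by
    by_contra hp
    refine not_eventuallyEq_cos_sq_const r
      ((linearCoefficient h r + 2 / (1 - q)) / ((2 / (1 - q)) ^ 2 + 2 / (1 - q))) ?_
    filter_upwards [hA] with s hs
    rw [eq_div_iff hp, mul_comm, hs]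
  have hq' : 1 - q ≠ 0 := sub_ne_zero.2 hq.symm
  field_simp at hp
  linarith

theorem isNewtonSolution (hu : IsSeparatedSolution ε 3 J h w) (hε : ε ≠ 0) (hJ : IsOpen J)
    (hsin : ∀ r ∈ J, sin r ≠ 0) (hr : r ∈ J) (hhr : h r ≠ 0) :
    IsNewtonSolution (fun x => -x + ε * x ^ 3) fun θ => h r * sin r * w θ := by
  have hw₁ (θ : ℝ) : HasDerivAt w (deriv w θ) θ :=
    (hu.contDiff.differentiable two_ne_zero θ).hasDerivAt
  have hw₂ (θ : ℝ) : HasDerivAt (deriv w) (deriv (deriv w) θ) θ :=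
    ((hu.contDiff.deriv' (n := 1)).differentiable one_ne_zero θ).hasDerivAt
  refine .of_hasDerivAt (fun θ => (hw₁ θ).const_mul _) fun θ =>
    ((hw₂ θ).const_mul _).congr_deriv ?_
  rw [hu.deriv_deriv_eq hr (hsin r hr) hhr,
    hu.linearCoefficient_eq hε (by norm_num) hJ hsin hr hhr, powerCoefficient_three,
    show (3 : ℝ) - 1 = (2 : ℕ) by norm_num, rpow_natCast, sq_abs]
  ring

theorem mul_sin_eq (hu : IsSeparatedSolution ε 3 J h w) (hε : ε ≠ 0) (hJ : IsPreconnected J)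
    (hsin : ∀ r ∈ J, sin r ≠ 0) (hr : r ∈ J) (hhr : h r ≠ 0) (hs : s ∈ J) :
    h s * sin s = h r * sin r := by
  have hcont : ContinuousOn (fun s => h s * sin s) J := fun s hs =>
    ((hu.differentiableAt s hs).continuousAt.mul continuous_sin.continuousAt).continuousWithinAt
  refine eq_of_abs_eq_of_ne_zero hJ hcont (m := |h r * sin r|) (fun t ht hne => ?_) hs hr
  have hκ := (hu.coefficients_eq hε (by norm_num) hsin ht (left_ne_zero_of_mul hne) hr hhr).2
  rwa [powerCoefficient_three, powerCoefficient_three, sq_eq_sq_iff_abs_eq_abs] at hκ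

end IsSeparatedSolution

section PseudoRadial

variable {Ω : Set S2} {ε q : ℝ} {u : S2 → ℝ} {h w : ℝ → ℝ}

theorem IsAxiallySymmetric.forall_polarPoint_iff (hΩ : IsAxiallySymmetric Ω) {p : ℝ → ℝ → Prop} :
    (∀ r ∈ Ioo 0 π, ∀ θ, polarPoint r θ ∈ Ω → p r θ) ↔ ∀ r ∈ radii Ω, ∀ θ, p r θ :=
  ⟨fun hp r hr θ => hp r hr.1 θ ((hΩ.mem_radii_iff θ).1 hr).2,
    fun hp r hr θ hm => hp r ((hΩ.mem_radii_iff θ).2 ⟨hr, hm⟩) θ⟩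

theorem exists_ne_of_not_isRadial (hΩ : IsAxiallySymmetric Ω)
    (huw : ∀ r ∈ radii Ω, ∀ θ, u (polarPoint r θ) = h r * w θ) (hrad : ¬ IsRadial Ω u) :
    (∃ r ∈ radii Ω, h r ≠ 0) ∧ ∃ a b, w a ≠ w b := by
  constructor <;> by_contra! hcon
  · exact hrad ⟨0, hΩ.forall_polarPoint_iff.2 fun r hr θ => by simp [huw r hr, hcon r hr]⟩
  · exact hrad ⟨fun r => h r * w 0, hΩ.forall_polarPoint_iff.2 fun r hr θ => by
      rw [huw r hr, hcon θ 0]⟩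

theorem contDiff_polarPoint_angle (r : ℝ) {n : WithTop ℕ∞} :
    ContDiff ℝ n fun θ => (polarPoint r θ : E3) := by
  refine contDiff_piLp' 2 fun i => ?_
  fin_cases i
  exacts [contDiff_const.mul contDiff_cos, contDiff_const.mul contDiff_sin, contDiff_const]

theorem contDiff_angular (hΩ : IsAxiallySymmetric Ω) {f : ℝ → ℝ} (hu : IsSphereSolution Ω f u)
    (huw : ∀ r ∈ radii Ω, ∀ θ, u (polarPoint r θ) = h r * w θ) {r : ℝ} (hr : r ∈ radii Ω)
    (hhr : h r ≠ 0) : ContDiff ℝ 2 w := by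
  have hw : w = fun θ => (h r)⁻¹ * radialExtension u (polarPoint r θ) := funext fun θ => by
    rw [radialExtension_coe, huw r hr, inv_mul_cancel_left₀ hhr]
  rw [hw]
  refine contDiff_const.mul (contDiff_iff_contDiffAt.2 fun θ => ?_)
  exact (hu _ (hΩ.polarPoint_mem_awayFromPoles hr θ)).1.comp θ
    (contDiff_polarPoint_angle r).contDiffAt

theorem differentiableAt_radial (hΩ : IsAxiallySymmetric Ω) (hopen : IsOpen Ω) {f : ℝ → ℝ}
    (hu : IsSphereSolution Ω f u) (huw : ∀ r ∈ radii Ω, ∀ θ, u (polarPoint r θ) = h r * w θ)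
    {θ : ℝ} (hθ : w θ ≠ 0) {r : ℝ} (hr : r ∈ radii Ω) : DifferentiableAt ℝ h r := by
  have hU := (hu _ (hΩ.polarPoint_mem_awayFromPoles hr θ)).1.differentiableAt two_ne_zero
  have hcomp : DifferentiableAt ℝ (fun r => radialExtension u (polarPoint r θ) * (w θ)⁻¹) r :=
    (hU.comp r (hasDerivAt_polarPoint_radius r θ).differentiableAt).mul_const _
  refine hcomp.congr_of_eventuallyEq ?_
  filter_upwards [(isOpen_radii hopen).mem_nhds hr] with s hs
  rw [radialExtension_coe, huw s hs, mul_inv_cancel_right₀ hθ]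

theorem isSeparatedSolution_of_not_isRadial (hΩ : IsAxiallySymmetric Ω) (hopen : IsOpen Ω)
    (hu : IsSphereSolution Ω (fun t => ε * (t * |t| ^ (q - 1))) u)
    (huw : ∀ r ∈ radii Ω, ∀ θ, u (polarPoint r θ) = h r * w θ) (hrad : ¬ IsRadial Ω u) :
    IsSeparatedSolution ε q (radii Ω) h w := by
  obtain ⟨⟨r₀, hr₀, hh₀⟩, hne⟩ := exists_ne_of_not_isRadial hΩ huw hrad
  obtain ⟨θ₀, hθ₀⟩ : ∃ θ, w θ ≠ 0 := by
    by_contra! hw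
    simp [hw] at hne
  refine ⟨fun r hr => differentiableAt_radial hΩ hopen hu huw hθ₀ hr,
    contDiff_angular hΩ hu huw hr₀ hh₀, hne, fun r hr θ => ?_⟩
  obtain ⟨hU, hlap⟩ := hu _ (hΩ.polarPoint_mem_awayFromPoles hr θ)
  have hradial : (fun r => u (polarPoint r θ)) =ᶠ[𝓝 r] fun r => h r * w θ := by
    filter_upwards [(isOpen_radii hopen).mem_nhds hr] with s hs using huw s hs θ
  rw [sphereLaplacian_polarPoint (sin_pos_of_mem_radii hr).ne' hU, hradial.deriv.deriv_eq,
    hradial.deriv_eq, funext (huw r hr)] at hlap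
  simpa only [deriv_mul_const_field', deriv_const_mul_field', deriv_mul_const_field,
    deriv_const_mul_field, huw r hr θ] using hlap

theorem isRadial_of_isPseudoRadial (hΩ : IsAxiallySymmetric Ω) (hopen : IsOpen Ω) (hε : ε ≠ 0)
    (hq : q ≠ 1) (hεq : 0 < ε ∨ q ≠ 3)
    (hu : IsSphereSolution Ω (fun t => ε * (t * |t| ^ (q - 1))) u) (hps : IsPseudoRadial Ω u) :
    IsRadial Ω u := by
  obtain ⟨h, w, hper, huw⟩ := hps
  rw [hΩ.forall_polarPoint_iff] at huw
  by_contra hrad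
  obtain ⟨⟨r, hr, hhr⟩, a, b, hab⟩ := exists_ne_of_not_isRadial hΩ huw hrad
  have hsep := isSeparatedSolution_of_not_isRadial hΩ hopen hu huw hrad
  have hsin : ∀ r ∈ radii Ω, sin r ≠ 0 := fun r hr => (sin_pos_of_mem_radii hr).ne'
  obtain rfl : q = 3 := hsep.eq_three hε hq (isOpen_radii hopen) hsin hr hhr
  have hεpos : 0 < ε := hεq.resolve_right (not_not_intro rfl)
  have hW := hsep.isNewtonSolution hε (isOpen_radii hopen) hsin hr hhr
  obtain ⟨c, hc⟩ := Defocusing.eq_const_of_periodic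
    (Defocusing.isNewtonSolution_sqrt_mul hεpos.le hW) fun θ => by simp only [hper θ]
  have hne : √ε * (h r * sin r) ≠ 0 := by
    have := hsin r hr
    positivity
  have hconst (θ : ℝ) : √ε * (h r * sin r) * w θ = c := by
    rw [mul_assoc]
    exact congrFun hc θ
  exact hab (mul_left_cancel₀ hne ((hconst a).trans (hconst b).symm))

end PseudoRadial

section ProfileSolutions

variable {Ω : Set S2} {u v : S2 → ℝ} {w f : ℝ → ℝ}

theorem IsSphereSolution.congr (hu : IsSphereSolution Ω f u) (hopen : IsOpen Ω)
    (huv : EqOn u v (awayFromPoles Ω)) : IsSphereSolution Ω f v := by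
  intro x hx
  have hext : radialExtension u =ᶠ[𝓝 (x : E3)] radialExtension v :=
    radialExtension_congr (huv.eventuallyEq_of_mem ((isOpen_awayFromPoles hopen).mem_nhds hx))
  obtain ⟨hU, hlap⟩ := hu x hx
  refine ⟨hU.congr_of_eventuallyEq hext.symm, ?_⟩
  rw [sphereLaplacian, ← (InnerProductSpace.laplacian_congr_nhds hext).eq_of_nhds, ← huv hx]
  exact hlap

theorem hasDerivAt_div_sin (c : ℝ) {r : ℝ} (hr : sin r ≠ 0) :
    HasDerivAt (fun r => c / sin r) (-c * cos r / sin r ^ 2) r :=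
  ((hasDerivAt_const r c).div (hasDerivAt_sin r) hr).congr_deriv (by ring)

theorem deriv_deriv_div_sin (c : ℝ) {r : ℝ} (hr : sin r ≠ 0) :
    deriv (deriv fun r => c / sin r) r = c * (1 + cos r ^ 2) / sin r ^ 3 := by
  have hderiv : deriv (fun r => c / sin r) =ᶠ[𝓝 r] fun r => -c * cos r / sin r ^ 2 := by
    filter_upwards [continuous_sin.continuousAt.eventually_ne hr] with s hs
    exact (hasDerivAt_div_sin c hs).deriv
  rw [hderiv.deriv_eq, (((hasDerivAt_cos r).const_mul (-c)).fun_div ((hasDerivAt_sin r).fun_pow 2)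
    (pow_ne_zero 2 hr)).deriv]
  simp only [Nat.cast_ofNat, Nat.reduceSub, pow_one]
  field_simp
  linear_combination c * sin_sq_add_cos_sq r

theorem isSphereSolution_angularProfile (hw : SolvesODE w) (hper : Function.Periodic w (2 * π)) :
    IsSphereSolution Ω (fun t => -t ^ 3) (angularProfile w) := by
  rintro x hx
  have hU := contDiffAt_radialExtension_angularProfile hw.1 hper (mem_awayFromPoles_iff.1 hx).2
  obtain ⟨r, hr, θ, rfl, -⟩ := hx
  have hsin : sin r ≠ 0 := (sin_pos_of_mem_Ioo hr).ne'
  have hradial : (fun r => angularProfile w (polarPoint r θ)) =ᶠ[𝓝 r] fun r => w θ / sin r := by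
    filter_upwards [isOpen_Ioo.mem_nhds hr] with s hs using angularProfile_polarPoint hper hs θ
  have hode : deriv (deriv w) θ = Duffing.force (w θ) :=
    ((solvesODE_iff.1 hw).hasDerivAt_deriv θ).deriv
  have hangular : deriv (deriv fun θ => w θ / sin r) θ = Duffing.force (w θ) / sin r := by
    rw [show deriv (fun θ => w θ / sin r) = fun θ => deriv w θ / sin r from
      funext fun _ => deriv_div_const _, deriv_div_const, hode]
  refine ⟨hU, ?_⟩
  rw [sphereLaplacian_polarPoint hsin hU, hradial.deriv.deriv_eq, hradial.deriv_eq,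
    funext (angularProfile_polarPoint hper hr), hangular, angularProfile_polarPoint hper hr,
    deriv_deriv_div_sin _ hsin, (hasDerivAt_div_sin _ hsin).deriv, Duffing.force]
  field_simp
  ring

theorem not_isRadial_of_eq_div_sin (hΩ : IsAxiallySymmetric Ω) (hne : (radii Ω).Nonempty)
    (hu : ∀ r ∈ radii Ω, ∀ θ, u (polarPoint r θ) = w θ / sin r) (hw : ∃ a b, w a ≠ w b) :
    ¬ IsRadial Ω u := by
  rintro ⟨h, hh⟩
  rw [hΩ.forall_polarPoint_iff] at hh
  obtain ⟨r, hr⟩ := hne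
  obtain ⟨a, b, hab⟩ := hw
  have hval (θ : ℝ) : w θ / sin r = h r := (hu r hr θ).symm.trans (hh r hr θ)
  exact hab ((div_left_inj' (sin_pos_of_mem_radii hr).ne').1 ((hval a).trans (hval b).symm))

theorem IsRotSymmDomain.exists_eq_div_sin (hΩ : IsRotSymmDomain Ω)
    (hu : u ∈ nonradialPseudoRadialSolutions Ω) :
    ∃ w, SolvesODE w ∧ Function.Periodic w (2 * π) ∧ (∃ a b, w a ≠ w b) ∧
      ∀ r ∈ radii Ω, ∀ θ, u (polarPoint r θ) = w θ / sin r := by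
  obtain ⟨hsol, ⟨h, w, hper, huw⟩, hrad⟩ := hu
  rw [hΩ.isAxiallySymmetric.forall_polarPoint_iff] at huw
  have hcubic : (fun t : ℝ => -t ^ 3) = fun t => -1 * (t * |t| ^ ((3 : ℝ) - 1)) := by
    funext t
    rw [show (3 : ℝ) - 1 = (2 : ℕ) by norm_num, rpow_natCast, sq_abs]
    ring
  rw [hcubic] at hsol
  have hε : (-1 : ℝ) ≠ 0 := by norm_num
  have hsin : ∀ r ∈ radii Ω, sin r ≠ 0 := fun r hr => (sin_pos_of_mem_radii hr).ne'
  obtain ⟨⟨r, hr, hhr⟩, a, b, hab⟩ := exists_ne_of_not_isRadial hΩ.isAxiallySymmetric huw hrad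
  have hsep :=
    isSeparatedSolution_of_not_isRadial hΩ.isAxiallySymmetric hΩ.isOpen hsol huw hrad
  have hpre := hΩ.isAxiallySymmetric.isPreconnected_radii hΩ.isConnected.isPreconnected
  refine ⟨fun θ => h r * sin r * w θ, solvesODE_iff.2 ?_, fun θ => by simp only [hper θ],
    ⟨a, b, fun e => hab (mul_left_cancel₀ (mul_ne_zero hhr (hsin r hr)) e)⟩, fun s hs θ => ?_⟩
  · convert hsep.isNewtonSolution hε (isOpen_radii hΩ.isOpen) hsin hr hhr using 2 with x
    rw [Duffing.force]
    ring
  · rw [huw s hs, eq_div_iff (hsin s hs), mul_right_comm, hsep.mul_sin_eq hε hpre hsin hr hhr hs]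

theorem IsRotSymmDomain.mem_nonradialPseudoRadialSolutions_iff (hΩ : IsRotSymmDomain Ω) :
    u ∈ nonradialPseudoRadialSolutions Ω ↔ ∃ w, SolvesODE w ∧ Function.Periodic w (2 * π) ∧
      (∃ a b, w a ≠ w b) ∧ ∀ r ∈ radii Ω, ∀ θ, u (polarPoint r θ) = w θ / sin r := by
  have hsymm := hΩ.isAxiallySymmetric
  refine ⟨hΩ.exists_eq_div_sin, fun ⟨w, hw, hper, hne, huw⟩ => ⟨?_, ?_, ?_⟩⟩
  · refine (isSphereSolution_angularProfile hw hper).congr hΩ.isOpen ?_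
    rintro _ ⟨r, hr, θ, rfl, hm⟩
    rw [angularProfile_polarPoint hper hr, huw r ((hsymm.mem_radii_iff θ).2 ⟨hr, hm⟩)]
  · refine ⟨fun r => (sin r)⁻¹, w, hper, hsymm.forall_polarPoint_iff.2 fun r hr θ => ?_⟩
    rw [huw r hr, div_eq_inv_mul]
  · exact not_isRadial_of_eq_div_sin hsymm
      (hsymm.nonempty_radii hΩ.isOpen hΩ.isConnected.nonempty) huw hne

end ProfileSolutions

/-! ### Classification of pseudo-radial solutions -/

section Classification

variable {Ω : Set S2} {w : ℝ → ℝ}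

theorem two_pi_div_mem_Ioo {k : ℕ} (hk : 2 ≤ k) : 2 * π / k ∈ Ioo 0 (2 * π) := by
  have hk' : (1 : ℝ) < k := by exact_mod_cast hk
  exact ⟨by positivity, div_lt_self two_pi_pos hk'⟩

theorem HasLeastPeriod.periodic_two_pi {k : ℕ} (hk : k ≠ 0) (hw : HasLeastPeriod w (2 * π / k)) :
    Function.Periodic w (2 * π) := by
  have h := hw.1.2.nat_mul k
  rwa [mul_div_cancel₀ _ (Nat.cast_ne_zero.2 hk)] at h

theorem HasLeastPeriod.exists_ne {T : ℝ} (hw : HasLeastPeriod w T) : ∃ a b, w a ≠ w b := by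
  by_contra! h
  have hconst : w = fun _ => w 0 := funext fun t => h t 0
  exact not_hasLeastPeriod_const (w 0) T (hconst ▸ hw)

theorem Duffing.nonconstant_periodic_iff :
    (SolvesODE w ∧ Function.Periodic w (2 * π) ∧ ∃ a b, w a ≠ w b) ↔
      ∃ k : ℕ, 2 ≤ k ∧ ∃ c, w = fun θ => oscillation (amplitude (2 * π / k)) (θ + c) := by
  constructor
  · rintro ⟨hw, hper, a, b, hab⟩
    have hw₀ : w ≠ 0 := by
      rintro rfl
      exact hab rfl
    obtain ⟨k, hk, hT⟩ := exists_hasLeastPeriod_two_pi_div (solvesODE_iff.1 hw) hw₀ hper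
    exact ⟨k, hk, exists_eq_translate_of_hasLeastPeriod (solvesODE_iff.1 hw) hT⟩
  · rintro ⟨k, hk, c, rfl⟩
    have hT := (hasLeastPeriod_comp_add_const_iff c).2
      (hasLeastPeriod_oscillation_amplitude (two_pi_div_mem_Ioo hk))
    exact ⟨solvesODE_iff.2 ((isNewtonSolution_oscillation _).comp_add_const c),
      hT.periodic_two_pi (by omega), hT.exists_ne⟩

theorem IsRotSymmDomain.mem_nonradialPseudoRadialSolutions_iff_oscillation
    (hΩ : IsRotSymmDomain Ω) {u : S2 → ℝ} :
    u ∈ nonradialPseudoRadialSolutions Ω ↔ ∃ k : ℕ, 2 ≤ k ∧ ∃ c : ℝ, ∀ r ∈ Ioo 0 π, ∀ θ : ℝ,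
      polarPoint r θ ∈ Ω → u (polarPoint r θ) =
        Duffing.oscillation (Duffing.amplitude (2 * π / k)) (θ + c) / sin r := by
  simp only [hΩ.isAxiallySymmetric.forall_polarPoint_iff]
  refine hΩ.mem_nonradialPseudoRadialSolutions_iff.trans ⟨?_, ?_⟩
  · rintro ⟨w, hw, hper, hne, hu⟩
    obtain ⟨k, hk, c, rfl⟩ := Duffing.nonconstant_periodic_iff.1 ⟨hw, hper, hne⟩
    exact ⟨k, hk, c, hu⟩
  · rintro ⟨k, hk, c, hu⟩
    obtain ⟨hw, hper, hne⟩ := Duffing.nonconstant_periodic_iff.2 ⟨k, hk, c, rfl⟩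
    exact ⟨_, hw, hper, hne, hu⟩

theorem infinite_nonradialPseudoRadialSolutions (hΩ : IsRotSymmDomain Ω) :
    ((fun u : S2 → ℝ => (awayFromPoles Ω).domRestrict u) ''
      nonradialPseudoRadialSolutions Ω).Infinite := by
  have hT (k : ℕ) := Duffing.hasLeastPeriod_oscillation_amplitude
    (two_pi_div_mem_Ioo (Nat.le_add_left 2 k))
  have hval (k : ℕ) {r : ℝ} (hr : r ∈ Ioo 0 π) (θ : ℝ) :=
    angularProfile_polarPoint ((hT k).periodic_two_pi (Nat.succ_ne_zero _)) hr θ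
  refine infinite_of_injective_forall_mem (fun i j hij => ?_) fun k => mem_image_of_mem _
    (hΩ.mem_nonradialPseudoRadialSolutions_iff_oscillation.2
      ⟨k + 2, Nat.le_add_left 2 k, 0, fun r hr θ _ => by rw [add_zero]; exact hval k hr θ⟩)
  obtain ⟨r, hr⟩ := hΩ.isAxiallySymmetric.nonempty_radii hΩ.isOpen hΩ.isConnected.nonempty
  have hprofile : Duffing.oscillation (Duffing.amplitude (2 * π / ↑(i + 2))) =
      Duffing.oscillation (Duffing.amplitude (2 * π / ↑(j + 2))) := funext fun θ => by
    have h := congrFun hij ⟨_, hΩ.isAxiallySymmetric.polarPoint_mem_awayFromPoles hr θ⟩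
    simp only [domRestrict_apply, hval _ hr.1] at h
    exact (div_left_inj' (sin_pos_of_mem_radii hr).ne').1 h
  have hperiod := (hT i).unique (hprofile ▸ hT j)
  simpa [div_eq_mul_inv, pi_ne_zero] using hperiod

end Classification

-- For `q ≤ 0` the nonlinearity `t * |t| ^ (q - 1)` takes the value `0` at `t = 0`.
theorem theorem4p5_general :
    (∀ Ω : Set S2, IsOpen Ω → IsAxiallySymmetric Ω →
      ∀ ε q : ℝ, ε ≠ 0 → q ≠ 1 → (0 < ε ∨ q ≠ 3) →
        ∀ u : S2 → ℝ, IsSphereSolution Ω (fun t => ε * (t * |t| ^ (q - 1))) u →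
          IsPseudoRadial Ω u → IsRadial Ω u) ∧
    ∃ w : ℝ → ℝ → ℝ,
      (∀ T ∈ Ioo 0 (2 * π),
        SolvesODE (w T) ∧ HasLeastPeriod (w T) T ∧ w T 0 = 0 ∧
        (∀ v : ℝ → ℝ, SolvesODE v → HasLeastPeriod v T → v 0 = 0 → v = w T ∨ v = -w T) ∧
        ∀ v : ℝ → ℝ, SolvesODE v → HasLeastPeriod v T → ∃ c, ∀ θ, v θ = w T (θ + c)) ∧
      ∀ Ω : Set S2, IsRotSymmDomain Ω →
        ((fun u : S2 → ℝ => (awayFromPoles Ω).domRestrict u) ''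
          nonradialPseudoRadialSolutions Ω).Infinite ∧
        ∀ u : S2 → ℝ, u ∈ nonradialPseudoRadialSolutions Ω ↔
          ∃ k : ℕ, 2 ≤ k ∧ ∃ c : ℝ, ∀ r ∈ Ioo 0 π, ∀ θ : ℝ, polarPoint r θ ∈ Ω →
            u (polarPoint r θ) = w (2 * π / k) (θ + c) / sin r := by
  refine ⟨fun Ω hopen hΩ ε q hε hq hεq u hu hps =>
      isRadial_of_isPseudoRadial hΩ hopen hε hq hεq hu hps,
    fun T => Duffing.oscillation (Duffing.amplitude T), fun T hT => ⟨?_, ?_, ?_, ?_, ?_⟩,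
    fun Ω hΩ => ⟨infinite_nonradialPseudoRadialSolutions hΩ, fun u =>
      hΩ.mem_nonradialPseudoRadialSolutions_iff_oscillation⟩⟩
  · exact solvesODE_iff.2 (Duffing.isNewtonSolution_oscillation _)
  · exact Duffing.hasLeastPeriod_oscillation_amplitude hT
  · exact Duffing.oscillation_zero_right _
  · exact fun v hv => Duffing.eq_or_eq_neg_of_hasLeastPeriod (solvesODE_iff.1 hv)
  · exact fun v hv hvT => (Duffing.exists_eq_translate_of_hasLeastPeriod (solvesODE_iff.1 hv)
      hvT).imp fun _ => congrFun

theorem theorem4p5 :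
    (∀ (Ω : Set S2), IsRotSymmDomain Ω →
      ∀ (ε q : ℝ), (ε = 1 ∨ ε = -1) → 0 < q → q ≠ 1 → (ε = 1 ∨ q ≠ 3) →
        ∀ u : S2 → ℝ, IsSphereSolution Ω (fun t => ε * (t * |t| ^ (q - 1))) u →
          IsPseudoRadial Ω u → IsRadial Ω u) ∧
    (∃ w : ℕ → ℝ → ℝ,
      (∀ k : ℕ, 2 ≤ k →
        SolvesODE (w k) ∧ HasLeastPeriod (w k) (2 * Real.pi / k) ∧ w k 0 = 0 ∧
        (∀ v : ℝ → ℝ, SolvesODE v → HasLeastPeriod v (2 * Real.pi / k) → v 0 = 0 →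
          v = w k ∨ v = -w k) ∧
        (∀ v : ℝ → ℝ, SolvesODE v → HasLeastPeriod v (2 * Real.pi / k) →
          ∃ c : ℝ, ∀ θ : ℝ, v θ = w k (θ + c))) ∧
      (∀ (Ω : Set S2), IsRotSymmDomain Ω →
        ((fun u : S2 → ℝ => (awayFromPoles Ω).domRestrict u) ''
          nonradialPseudoRadialSolutions Ω).Infinite ∧
        ∀ u : S2 → ℝ, u ∈ nonradialPseudoRadialSolutions Ω ↔
          ∃ k : ℕ, 2 ≤ k ∧ ∃ c : ℝ, ∀ r ∈ Set.Ioo 0 Real.pi, ∀ θ : ℝ,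
            polarPoint r θ ∈ Ω → u (polarPoint r θ) = w k (θ + c) / Real.sin r)) := by
  obtain ⟨hradial, w, hw, hclass⟩ := theorem4p5_general
  refine ⟨fun Ω hΩ ε q hε _ hq hεq => hradial Ω hΩ.isOpen hΩ.isAxiallySymmetric ε q ?_ hq ?_,
    fun k => w (2 * π / k), fun k hk => hw _ (two_pi_div_mem_Ioo hk), hclass⟩
  · rcases hε with rfl | rfl <;> norm_num
  · exact hεq.imp_left fun h => one_pos.trans_eq h.symm
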